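/- **Setting.** Let $\mathcal S,\mathcal A$ be measurable spaces, $\mathcal P\subseteq\mathbb R^d$, $\gamma\in[0,1)$. A parameterized MDP consists of an initial distribution on $\mathcal S$, a transition kernel $T(\cdot\mid s,a,p)$ on $\mathcal S$, a reward kernel $R(\cdot\mid s,a,s',p)$ on $\mathbb R$, and a distribution $\mathbb D$ of the environment parameter $p\in\mathcal P$. Let $\Pi=\{\pi_\theta:\theta\in\Theta\}$ be a (jointly measurable) family of stochastic policies, $J(\pi,p)=\mathbb E\big[\sum_{t\ge 0}\gamma^t r_t\big]$ the expected return of $\pi$ under the parameter $p$, where $r_t\sim R(\cdot\mid s_t,a_t,s_{t+1},p)$, $h(\pi,p)=\mathbb D\{p': J(\pi,p')\le J(\pi,p)\}$, and, for a non-increasing $W:[0,1]\to[0,\infty)$, let $\mathcal E(\pi)=\int_{\mathcal P} J(\pi,p)\,W(h(\pi,p))\,\mathrm d\mathbb D(p)$ be the UOR metric. Write $D_{TV}(\mu,\nu)=\sup_B|\mu(B)-\nu(B)|$. **Assumptions on the model.** (i) All rewards lie in $[-R_{\max},R_{\max}]$. (ii) $D_{TV}(T(\cdot\mid s,a,p),T(\cdot\mid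 s,a,p'))\le L_{T,p}\|p-p'\|_2$, and the mean of $R(\cdot\mid s,a,s',p)$ is $L_{R,p}$-Lipschitz in $p$, for all $s,a,s'$. (iii) For every $\pi\in\Pi$ and $x\in\mathbb R$, $\mathbb D\{p:J(\pi,p)=x\}=0$. **Algorithm (DF-UOR-RL with $n$ clusters of size $m$).** In each iteration $i=0,1,2,\dots$ the current policy is a function of what has happened so far, possibly randomized (arbitrary Policy\_Update). For $j=1,\dots,n$ and $k=1,\dots,m$ one observes an environment parameter $p_{j,k}$, whose law is $\mathbb D$ (the parameters may be dependent), and executes a policy under it; given the past and $p_{j,k}$, the resulting trajectory has the law prescribed by the MDP. For any policy $\pi$ chosen on the basis of what happened before iteration $i$, let $\hat J_j$ be the average discounted reward of the $m$ trajectories of cluster $j$ when $\pi$ is executed, let $\hat J_{\alpha_1}\le\dots\le\hat J_{\alpha_n}$ be the increasing rearrangement, and let $\tilde{\mathcal E}(\pi)=\sum_{j=1}^n \hat J_{\alpha_j}\int_{(j-1)/n}^{j/n}W(x)\,\mathrm dx$ be the metric evaluated in iteration $i$. The output $\tilde\pi$ is the policy after any fixed number $i\ge 0$ of updates, and $\tilde{\mathcal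 E}$ is then the metric evaluated in iteration $i$, i.e. with trajectories collected after $\tilde\pi$ has been determined. **Assumption 5 (with parameters $\upsilon,\varepsilon,B$).** Almost surely, $\|p_{j,k}-p_{j,k+1}\|_2<\frac{\upsilon\varepsilon}{2m}$ for consecutive parameters of the same cluster. Number the clusters consecutively through all iterations. For every cluster $x$ and $y\ge x$ let $\mathbb D_x^y$ be the posterior distribution of the first parameter of cluster $y$ given what was observed before the iteration that contains cluster $x$ and the first parameters of the clusters of this iteration up to $x$; then $\sum_{y\ge x}D_{TV}(\mathbb D,\mathbb D_x^y)\le B$ almost surely. **Theorem.** There is $\upsilon>0$ depending only on $\mathcal S,\mathcal A,\Theta,\mathcal P,\gamma,W,R_{\max},L_{T,p},L_{R,p}$ (not on the initial distribution, $T$, $R$, $\mathbb D$ or the policies) such that for all $B$ and $\rho_0<1$ there are constants $c_1,c_2>0$, depending only on these data and on $B,\rho_0$, with the following property. For every model as above, all $\varepsilon=2\varepsilon_0>0$ and $\rho\in(0,\rho_0]$, put $$n_1=c_1\,\frac{-\ln\rho}{\varepsilon^2},\qquad n_2=c_2\,\frac{-\ln\rho}{\varepsilon^{2d+2}} .$$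 If the number of clusters is $n>n_1$, the cluster size is $m>n_2$, and Assumption 5 holds with $\upsilon,\varepsilon,B$, then, with probability more than $1-\rho$, the following implication is true: if $\tilde\pi$ is $\varepsilon_0$-suboptimal for $\tilde{\mathcal E}$, that is $\tilde{\mathcal E}(\tilde\pi)\ge\tilde{\mathcal E}(\pi)-\varepsilon_0$ for all $\pi\in\Pi$, then $\mathcal E(\tilde\pi)\ge\mathcal E(\pi)-\varepsilon$ for all $\pi\in\Pi$. In particular, if Policy\_Update always outputs an $\varepsilon_0$-suboptimal policy for $\tilde{\mathcal E}$, then $\tilde\pi$ is $\varepsilon$-suboptimal for $\mathcal E$ with probability more than $1-\rho$. -/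

import Mathlib

open MeasureTheory ProbabilityTheory
open scoped ENNReal

namespace UORRL

noncomputable section

/-- Total variation distance `sup_B |μ(B) - ν(B)|` (over measurable sets `B`) of two probability
measures. -/
def tv {X : Type*} [MeasurableSpace X] (μ ν : Measure X) : ℝ :=
  ⨆ B : {B : Set X // MeasurableSet B}, |μ.real B.1 - ν.real B.1|

/-- `Q` is a (regular) conditional distribution under `μ` of the random element `Y` given the
σ-algebra `m`: each `Q ω` is a probability measure and `Q · B` is a version of `μ(Y ∈ B | m)`. -/
def IsCondLaw {Ω X : Type*} [mΩ : MeasurableSpace Ω] [MeasurableSpace X] (μ : Measure Ω)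
    (m : MeasurableSpace Ω) (Y : Ω → X) (Q : Ω → Measure X) : Prop :=
  (∀ ω, IsProbabilityMeasure (Q ω)) ∧
    ∀ B : Set X, MeasurableSet B → μ⟦Y ⁻¹' B | m⟧ =ᵐ[μ] fun ω => (Q ω).real B

/-- The stochastic data of a parameterized MDP with environment parameters in `P ⊆ ℝ^d`: initial
state distribution, transition function, reward function, and the distribution `D` of the
environment parameter. -/
structure PMDP (S A : Type*) [MeasurableSpace S] [MeasurableSpace A] {d : ℕ}
    (P : Set (EuclideanSpace ℝ (Fin d))) where
  /-- initial state distribution -/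
  init : Measure S
  /-- transition function `T(s, a, p)`, a distribution over next states -/
  T : Kernel (S × A × P) S
  /-- reward function `R(s, a, s', p)`, a distribution over real rewards -/
  R : Kernel (S × A × S × P) ℝ
  /-- distribution of the environment parameter -/
  D : Measure P
  init_prob : IsProbabilityMeasure init
  T_markov : IsMarkovKernel T
  R_markov : IsMarkovKernel R
  D_prob : IsProbabilityMeasure D

attribute [instance] PMDP.init_prob PMDP.T_markov PMDP.R_markov PMDP.D_prob

/-- A trajectory `z` records in `z t` the triple `(r_{t-1}, s_t, a_t)`, where `r_{t-1}` is the
reward of the transition from `s_{t-1}` to `s_t` (and `r_{-1} = 0`). -/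
abbrev Trajectory (S A : Type*) : Type _ := ℕ → ℝ × S × A

/-- Discounted reward `∑_{t ≥ 0} γ^t r_t` of a trajectory. -/
def discountedReward {S A : Type*} (γ : ℝ) (z : Trajectory S A) : ℝ :=
  ∑' t : ℕ, γ ^ t * (z (t + 1)).1

section Dynamics

variable {S A Θ : Type*} [MeasurableSpace S] [MeasurableSpace A] [MeasurableSpace Θ] {d : ℕ}
  {P : Set (EuclideanSpace ℝ (Fin d))}

/-- State of the controlled chain: the (constant) policy parameter and environment parameter,
together with the current triple `(r_{t-1}, s_t, a_t)`. -/
abbrev ChainState (Θ : Type*) {d : ℕ} (P : Set (EuclideanSpace ℝ (Fin d))) (S A : Type*) :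
    Type _ := (Θ × P) × (ℝ × S × A)

/-- Start: `s_0 ~ init`, `a_0 ~ π_θ(s_0)`, and `r_{-1} = 0`. -/
def startKernel (M : PMDP S A P) (pol : Kernel (Θ × S) A) :
    Kernel (Θ × P) (ChainState Θ P S A) :=
  Kernel.id ×ₖ
    (((Kernel.const (Θ × P) M.init) ⊗ₖ
        (pol.comap (fun y : (Θ × P) × S => (y.1.1, y.2)) (by fun_prop))).map
      (fun sa : S × A => ((0 : ℝ), sa.1, sa.2)))

/-- One step: `s' ~ T(s, a, p)`, then `r ~ R(s, a, s', p)` and `a' ~ π_θ(s')`; the parameters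
`θ` and `p` stay constant. -/
def stepKernel (M : PMDP S A P) (pol : Kernel (Θ × S) A) :
    Kernel (ChainState Θ P S A) (ChainState Θ P S A) :=
  Kernel.deterministic (fun x : ChainState Θ P S A => x.1) measurable_fst ×ₖ
    (((M.T.comap (fun x : ChainState Θ P S A => (x.2.2.1, x.2.2.2, x.1.2)) (by fun_prop)) ⊗ₖ
        ((M.R.comap (fun y : ChainState Θ P S A × S =>
            (y.1.2.2.1, y.1.2.2.2, y.2, y.1.1.2)) (by fun_prop)) ×ₖ
          (pol.comap (fun y : ChainState Θ P S A × S => (y.1.1.1, y.2)) (by fun_prop)))).map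
      (fun w : S × ℝ × A => (w.2.1, w.1, w.2.2)))

instance (M : PMDP S A P) (pol : Kernel (Θ × S) A) [IsMarkovKernel pol] :
    IsMarkovKernel (startKernel M pol) := by
  unfold startKernel
  have : IsMarkovKernel (((Kernel.const (Θ × P) M.init) ⊗ₖ
      (pol.comap (fun y : (Θ × P) × S => (y.1.1, y.2)) (by fun_prop))).map
      (fun sa : S × A => ((0 : ℝ), sa.1, sa.2))) :=
    Kernel.IsMarkovKernel.map _ (by fun_prop)
  infer_instance

instance (M : PMDP S A P) (pol : Kernel (Θ × S) A) [IsMarkovKernel pol] :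
    IsMarkovKernel (stepKernel M pol) := by
  unfold stepKernel
  have : IsMarkovKernel
    (((M.T.comap (fun x : ChainState Θ P S A => (x.2.2.1, x.2.2.2, x.1.2)) (by fun_prop)) ⊗ₖ
        ((M.R.comap (fun y : ChainState Θ P S A × S =>
            (y.1.2.2.1, y.1.2.2.2, y.2, y.1.1.2)) (by fun_prop)) ×ₖ
          (pol.comap (fun y : ChainState Θ P S A × S => (y.1.1.1, y.2)) (by fun_prop)))).map
      (fun w : S × ℝ × A => (w.2.1, w.1, w.2.2))) :=
    Kernel.IsMarkovKernel.map _ (by fun_prop)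
  infer_instance

/-- Law of the whole chain, started from a given initial state of the chain. -/
def chainKernel (M : PMDP S A P) (pol : Kernel (Θ × S) A) [IsMarkovKernel pol] :
    Kernel (ChainState Θ P S A) (ℕ → ChainState Θ P S A) :=
  (Kernel.traj (X := fun _ => ChainState Θ P S A)
    (fun n => (stepKernel M pol).comap
      (fun h : (i : Finset.Iic n) → ChainState Θ P S A => h ⟨n, by simp⟩)
      (measurable_pi_apply _)) 0).comap
    (fun x : ChainState Θ P S A => fun _ : Finset.Iic (0 : ℕ) => x)
    (measurable_pi_lambda _ fun _ => measurable_id)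

/-- Law of the trajectory obtained by executing the policy `π_θ` under the environment
parameter `p`, as a kernel in `(θ, p)`. -/
def trajKernel (M : PMDP S A P) (pol : Kernel (Θ × S) A) [IsMarkovKernel pol] :
    Kernel (Θ × P) (Trajectory S A) :=
  ((chainKernel M pol) ∘ₖ (startKernel M pol)).map (fun z t => (z t).2)

instance (M : PMDP S A P) (pol : Kernel (Θ × S) A) [IsMarkovKernel pol] :
    IsMarkovKernel (trajKernel M pol) := by
  have : IsMarkovKernel (chainKernel M pol) := by
    unfold chainKernel
    infer_instance
  unfold trajKernel
  exact Kernel.IsMarkovKernel.map _ (by fun_prop)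

/-- Expected return `J(π_θ, p)`. -/
def J (M : PMDP S A P) (pol : Kernel (Θ × S) A) [IsMarkovKernel pol] (γ : ℝ) (θ : Θ) (p : P) : ℝ :=
  ∫ z, discountedReward γ z ∂(trajKernel M pol (θ, p))

/-- Ranking function `h(π_θ, p)`: the `D`-probability that a random environment parameter gives
a return at most `J(π_θ, p)`. -/
def rank (M : PMDP S A P) (pol : Kernel (Θ × S) A) [IsMarkovKernel pol] (γ : ℝ) (θ : Θ) (p : P) :
    ℝ :=
  M.D.real {p' | J M pol γ θ p' ≤ J M pol γ θ p}

/-- UOR metric `𝓔(π_θ) = ∫ J(π_θ, p) W(h(π_θ, p)) dD(p)`. -/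
def uorMetric (M : PMDP S A P) (pol : Kernel (Θ × S) A) [IsMarkovKernel pol] (γ : ℝ) (W : ℝ → ℝ)
    (θ : Θ) : ℝ :=
  ∫ p, J M pol γ θ p * W (rank M pol γ θ p) ∂M.D

/-- All rewards lie in `[-Rmax, Rmax]`. -/
def BoundedReward (M : PMDP S A P) (Rmax : ℝ) : Prop :=
  ∀ x, ∀ᵐ r ∂(M.R x), |r| ≤ Rmax

/-- The transition function is `L`-Lipschitz in the environment parameter, for the total variation
distance on distributions over states. -/
def TransitionLipschitz (M : PMDP S A P) (L : ℝ) : Prop :=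
  ∀ (s : S) (a : A) (p p' : P), tv (M.T (s, a, p)) (M.T (s, a, p')) ≤ L * dist p p'

/-- The (mean) reward is `L`-Lipschitz in the environment parameter. -/
def RewardLipschitz (M : PMDP S A P) (L : ℝ) : Prop :=
  ∀ (s : S) (a : A) (s' : S) (p p' : P),
    |∫ r, r ∂(M.R (s, a, s', p)) - ∫ r, r ∂(M.R (s, a, s', p'))| ≤ L * dist p p'

/-- No policy of the class has a return that takes some value with positive `D`-probability. -/
def NoTies (M : PMDP S A P) (pol : Kernel (Θ × S) A) [IsMarkovKernel pol] (γ : ℝ) : Prop :=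
  ∀ (θ : Θ) (x : ℝ), M.D {p | J M pol γ θ p = x} = 0

/-- Metric calculation from the cluster performances `v 0, …, v (n-1)`: they are sorted
increasingly, and the one of rank `j` gets weight `∫_{j/n}^{(j+1)/n} W`. -/
def sortedMetric (W : ℝ → ℝ) (n : ℕ) (v : Fin n → ℝ) : ℝ :=
  ∑ j : Fin n, (∫ x in ((j : ℝ) / n)..(((j : ℝ) + 1) / n), W x) * v (Tuple.sort v j)

/-- The σ-algebra of a history `m`, the parameters `q j' k'` and trajectories `ζ j' k'`
(`k' < size`) of all executions before the `k`-th one of cluster `j`, and the parameter `q j k`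
of that execution. -/
abbrev executionPast {Ω X Z : Type*} [MeasurableSpace X] [MeasurableSpace Z] (m : MeasurableSpace Ω)
    (size : ℕ) (q : ℕ → ℕ → Ω → X) (ζ : ℕ → ℕ → Ω → Z) (j k : ℕ) : MeasurableSpace Ω :=
  m ⊔ (⨆ (j' : ℕ) (k' : ℕ) (_ : k' < size ∧ (j' < j ∨ (j' = j ∧ k' < k))),
      MeasurableSpace.comap (q j' k') inferInstance ⊔
        MeasurableSpace.comap (ζ j' k') inferInstance) ⊔
    MeasurableSpace.comap (q j k) inferInstance

/-- A run of the distribution-free algorithm with `n` clusters of size `m` on the probability space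
`(Ω, μ)`. Clusters are numbered through all iterations: iteration `i` uses the clusters
`i * n + j` with `j < n`. Cluster `t` consists of the executions `k < m`. -/
structure DFRun (M : PMDP S A P) (pol : Kernel (Θ × S) A) [IsMarkovKernel pol] (n m : ℕ)
    {Ω : Type*} [mΩ : MeasurableSpace Ω] (μ : Measure Ω) where
  /-- everything that happened before iteration `i` (including the randomness that the policy
  updates before iteration `i` used) -/
  hist : Filtration ℕ mΩ
  /-- parameter of the policy of iteration `i`, i.e. the policy after `i` policy updates -/
  θ : ℕ → Ω → Θ
  /-- the `k`-th environment parameter observed in cluster `t` -/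
  p : ℕ → ℕ → Ω → P
  /-- the `k`-th trajectory of cluster `t` when the policy `π_ϑ` is executed -/
  ξ : Θ → ℕ → ℕ → Ω → Trajectory S A
  /-- each policy is determined by what happened before (arbitrary policy update) -/
  θ_hist : ∀ i, Measurable[hist i] (θ i)
  p_hist : ∀ i j k, j < n → k < m → Measurable[hist (i + 1)] (p (i * n + j) k)
  ξ_hist : ∀ i j k, j < n → k < m →
    Measurable[hist (i + 1)] (fun ω => ξ (θ i ω) (i * n + j) k ω)
  /-- environment parameters follow the prior distribution `D` (they need not be independent) -/
  p_law : ∀ t k, k < m → μ.map (p t k) = M.D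
  /-- executing in iteration `i` a policy `π_ϑ`, chosen on the basis of the history, under the
  observed parameter yields a trajectory with the law prescribed by the PMDP, whatever happened
  in the earlier executions -/
  execution : ∀ (i : ℕ) (ϑ : Ω → Θ), Measurable[hist i] ϑ → ∀ j k, j < n → k < m →
    Measurable (fun ω => ξ (ϑ ω) (i * n + j) k ω) ∧
    IsCondLaw μ
      (executionPast (hist i) m (fun j' k' => p (i * n + j') k')
        (fun j' k' ω => ξ (ϑ ω) (i * n + j') k' ω) j k)
      (fun ω => ξ (ϑ ω) (i * n + j) k ω)
      (fun ω => trajKernel M pol (ϑ ω, p (i * n + j) k ω))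

namespace DFRun

variable {M : PMDP S A P} {pol : Kernel (Θ × S) A} [IsMarkovKernel pol] {n m : ℕ}
  {Ω : Type*} [MeasurableSpace Ω] {μ : Measure Ω}

/-- Average discounted reward of the trajectories of cluster `t` when `π_ϑ` is executed. -/
def clusterMean (r : DFRun M pol n m μ) (γ : ℝ) (t : ℕ) (ϑ : Θ) (ω : Ω) : ℝ :=
  (∑ k ∈ Finset.range m, discountedReward γ (r.ξ ϑ t k ω)) / m

/-- The metric `𝓔̃(π_ϑ)` evaluated in iteration `i`. -/
def metric (r : DFRun M pol n m μ) (γ : ℝ) (W : ℝ → ℝ) (i : ℕ) (ϑ : Θ) (ω : Ω) : ℝ :=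
  sortedMetric W n (fun j => r.clusterMean γ (i * n + j) ϑ ω)

/-- Consecutive environment parameters of a cluster are at distance less than `δ`. -/
def SlowDrift (r : DFRun M pol n m μ) (δ : ℝ) : Prop :=
  ∀ t k, k + 1 < m → ∀ᵐ ω ∂μ, dist (r.p t k ω) (r.p t (k + 1) ω) < δ

/-- What is observed up to the first environment parameter of the `j`-th cluster of
iteration `i`. -/
abbrev observed (r : DFRun M pol n m μ) (i j : ℕ) : MeasurableSpace Ω :=
  r.hist i ⊔ ⨆ (j' : ℕ) (_ : j' ≤ j), MeasurableSpace.comap (r.p (i * n + j') 0) inferInstance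

/-- Mixing: for every cluster `x`, the posterior distributions `Q s` of the first parameters of the
clusters `x + s`, given the observations up to the first parameter of cluster `x`, satisfy
`∑_s tv(D, Q s) ≤ B`. -/
def PosteriorMixing (r : DFRun M pol n m μ) (B : ℝ) : Prop :=
  ∀ i j, j < n → ∃ Q : ℕ → Ω → Measure P,
    (∀ s, IsCondLaw μ (r.observed i j) (r.p (i * n + j + s) 0) (Q s)) ∧
    ∀ᵐ ω ∂μ, ∑' s, ENNReal.ofReal (tv M.D (Q s ω)) ≤ ENNReal.ofReal B

end DFRun

end Dynamics

end

end UORRL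

/-! Both metrics are the same functional of a distribution function. Let `Φ` be the primitive of `W`
and `C` a bound for all returns. Writing each value as `v = C - ∫ 1{v ≤ x} dx` over `[-C, C]` turns
the sorted sum into `C Φ(1) - ∫ Φ(F̂(x)) dx`, where `F̂` is the empirical distribution function of
the cluster means (`sortedMetric_eq`). Since returns have no ties, their law under `D` is atomless,
its distribution function `F` is uniformly distributed, and the UOR metric is `C Φ(1) - ∫ Φ(F(x))
dx` (`integral_mul_weight_cdf`). As `Φ` is `W 0`-Lipschitz on `[0, 1]`, the two differ by at most `W
0` times the `L¹`-distance of `F̂` and `F` (`abs_sortedMetric_sub_le`).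

That distance is split at the empirical distribution function of the exact returns `J` under the
first parameter of each cluster. Passing from the cluster means to these values costs the mean of
`|noise|` plus a drift term. The drift is small because `J` is Lipschitz in the parameter
(`abs_J_sub_le`): each step of the chain adds a fixed amount to the Lipschitz constant, and linear
growth is summable against `γ ^ t`. The noise of one cluster is an average of `m` bounded martingale
differences (`expMomentBound_noise`). For fixed `x`, the deviation of the second empirical
distribution function from `F(x)` is the final value of a Doob martingale, whose increments are
bounded because mixing bounds the expected future by `B` (`expMomentBound_rankDeviation`).

Both error terms are averages of absolute values, over `x` or over clusters. Jensen's inequality for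
`exp` and Fubini bound such an average as well as a single variable (`measure_le_integral_abs_le`),
so no union bound over levels or clusters is needed and dependence between clusters does no harm.

Uniformity over the policy class is not needed either. Concentration is applied to two policies
known before the iteration: the output, and one fixed nearly optimal policy. If both evaluations are
accurate to `ε / 8`, then `ε / 2`-suboptimality for the evaluated metric passes to `ε`-suboptimality
for the UOR metric. -/

namespace UORRL

noncomputable section

/-! ### Distribution functions and `L`-statistics -/

/-- Primitive of the weight function. -/
def weightPrim (W : ℝ → ℝ) (u : ℝ) : ℝ := ∫ x in (0 : ℝ)..u, W x

/-- Empirical distribution function of `v 0, …, v (n-1)`. -/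
def empCdf {n : ℕ} (v : Fin n → ℝ) (x : ℝ) : ℝ :=
  (∑ j, if v j ≤ x then (1 : ℝ) else 0) / n

/-- The layer formula behind the proof: it makes a value in `[-C, C]` an integral of indicators over
levels, so that sums over samples become integrals of distribution functions. -/
theorem integral_ite_le {C v : ℝ} (hv : |v| ≤ C) :
    ∫ x in (-C)..C, (if v ≤ x then (1 : ℝ) else 0) = C - v := by
  obtain ⟨h1, h2⟩ := abs_le.1 hv
  have hint : ∀ a b : ℝ, IntervalIntegrable (fun x => if v ≤ x then (1 : ℝ) else 0) volume a b := by
    intro a b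
    refine Monotone.intervalIntegrable fun x y hxy => ?_
    split_ifs <;> linarith
  rw [← intervalIntegral.integral_add_adjacent_intervals (hint (-C) v) (hint v C)]
  have e1 : ∫ x in (-C)..v, (if v ≤ x then (1 : ℝ) else 0) = 0 := by
    rw [intervalIntegral.integral_of_le h1, integral_Ioc_eq_integral_Ioo]
    refine setIntegral_eq_zero_of_forall_eq_zero fun x hx => ?_
    simp [hx.2]
  have e2 : ∫ x in v..C, (if v ≤ x then (1 : ℝ) else 0) = C - v := by
    have : ∫ x in v..C, (if v ≤ x then (1 : ℝ) else 0) = ∫ x in v..C, (1 : ℝ) := by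
      refine intervalIntegral.integral_congr fun x hx => ?_
      rw [Set.uIcc_of_le h2] at hx
      simp [hx.1]
    rw [this]; simp
  rw [e1, e2, zero_add]

theorem intervalIntegrable_ite_le (v a b : ℝ) :
    IntervalIntegrable (fun x => if v ≤ x then (1 : ℝ) else 0) volume a b := by
  refine Monotone.intervalIntegrable fun x y hxy => ?_
  split_ifs <;> linarith

theorem empCdf_nonneg {n : ℕ} (v : Fin n → ℝ) (x : ℝ) : 0 ≤ empCdf v x :=
  div_nonneg (Finset.sum_nonneg fun j _ => by split_ifs <;> norm_num) (Nat.cast_nonneg _)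

theorem empCdf_le_one {n : ℕ} (v : Fin n → ℝ) (x : ℝ) : empCdf v x ≤ 1 := by
  refine div_le_one_of_le₀ ?_ (Nat.cast_nonneg _)
  calc (∑ j, if v j ≤ x then (1 : ℝ) else 0) ≤ ∑ _j : Fin n, (1 : ℝ) :=
        Finset.sum_le_sum fun j _ => by split_ifs <;> norm_num
    _ = n := by simp

theorem empCdf_mono {n : ℕ} (v : Fin n → ℝ) : Monotone (empCdf v) := by
  intro x y hxy
  refine div_le_div_of_nonneg_right (Finset.sum_le_sum fun j _ => ?_) (Nat.cast_nonneg _)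
  split_ifs <;> linarith

theorem abs_empCdf_sub_le {n : ℕ} (v w : Fin n → ℝ) (x : ℝ) :
    |empCdf v x - empCdf w x| ≤
      (∑ j, |(if v j ≤ x then (1 : ℝ) else 0) - if w j ≤ x then (1 : ℝ) else 0|) / n := by
  rw [empCdf, empCdf, ← sub_div, abs_div, Nat.abs_cast, ← Finset.sum_sub_distrib]
  gcongr
  exact Finset.abs_sum_le_sum_abs _ _

/-- The two step functions differ, by one, exactly between `v` and `w`. -/
theorem integral_abs_ite_sub {C v w : ℝ} (hv : |v| ≤ C) (hw : |w| ≤ C) :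
    ∫ x in (-C)..C, |(if v ≤ x then (1 : ℝ) else 0) - if w ≤ x then (1 : ℝ) else 0| = |v - w| := by
  wlog h : v ≤ w generalizing v w
  · rw [abs_sub_comm v w, ← this hw hv (le_of_not_ge h)]
    simp_rw [abs_sub_comm]
  have : ∀ x : ℝ, |(if v ≤ x then (1 : ℝ) else 0) - if w ≤ x then (1 : ℝ) else 0| =
      (if v ≤ x then (1 : ℝ) else 0) - if w ≤ x then (1 : ℝ) else 0 := by
    intro x
    apply abs_of_nonneg
    split_ifs <;> linarith
  simp_rw [this]
  rw [intervalIntegral.integral_sub (intervalIntegrable_ite_le _ _ _)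
    (intervalIntegrable_ite_le _ _ _), integral_ite_le hv, integral_ite_le hw,
    abs_of_nonpos (by linarith)]
  ring

/-- The `L¹`-distance of two empirical distribution functions is at most the mean distance of the
samples. -/
theorem integral_abs_empCdf_sub_le {n : ℕ} {C : ℝ} (v w : Fin n → ℝ) (hC : 0 ≤ C)
    (hv : ∀ j, |v j| ≤ C) (hw : ∀ j, |w j| ≤ C) :
    ∫ x in (-C)..C, |empCdf v x - empCdf w x| ≤ (∑ j, |v j - w j|) / n := by
  have hint : ∀ j, IntervalIntegrable (fun x =>
      |(if v j ≤ x then (1 : ℝ) else 0) - if w j ≤ x then (1 : ℝ) else 0|) volume (-C) C :=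
    fun j => ((intervalIntegrable_ite_le _ _ _).sub (intervalIntegrable_ite_le _ _ _)).abs
  calc ∫ x in (-C)..C, |empCdf v x - empCdf w x|
      ≤ ∫ x in (-C)..C,
        (∑ j, |(if v j ≤ x then (1 : ℝ) else 0) - if w j ≤ x then (1 : ℝ) else 0|) / n := by
        refine intervalIntegral.integral_mono_on (by linarith) ?_ ?_
          fun x _ => abs_empCdf_sub_le v w x
        · exact ((empCdf_mono v).intervalIntegrable.sub (empCdf_mono w).intervalIntegrable).abs
        · refine IntervalIntegrable.div_const ?_ _
          have := IntervalIntegrable.sum Finset.univ fun j _ => hint j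
          simpa only [Finset.sum_fn] using this
    _ = (∑ j, |v j - w j|) / n := by
        rw [intervalIntegral.integral_div,
          intervalIntegral.integral_finsetSum fun j _ => hint j]
        congr 1
        exact Finset.sum_congr rfl fun j _ => integral_abs_ite_sub (hv j) (hw j)

/-! ### The sorted metric as a functional of the empirical distribution function. -/

section Weight

variable {W : ℝ → ℝ}

theorem weight_intervalIntegrable (hW : AntitoneOn W (Set.Icc 0 1)) {a b : ℝ}
    (ha : a ∈ Set.Icc (0 : ℝ) 1) (hb : b ∈ Set.Icc (0 : ℝ) 1) :
    IntervalIntegrable W volume a b :=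
  AntitoneOn.intervalIntegrable (hW.mono (Set.uIcc_subset_Icc ha hb))

theorem weight_le (hW : AntitoneOn W (Set.Icc 0 1)) {x : ℝ} (hx : x ∈ Set.Icc (0 : ℝ) 1) :
    W x ≤ W 0 := hW ⟨le_rfl, zero_le_one⟩ hx hx.1

theorem weightPrim_sub (hW : AntitoneOn W (Set.Icc 0 1)) {a b : ℝ}
    (ha : a ∈ Set.Icc (0 : ℝ) 1) (hb : b ∈ Set.Icc (0 : ℝ) 1) :
    weightPrim W b - weightPrim W a = ∫ x in a..b, W x :=
  intervalIntegral.integral_interval_sub_left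
    (weight_intervalIntegrable hW ⟨le_rfl, zero_le_one⟩ hb)
    (weight_intervalIntegrable hW ⟨le_rfl, zero_le_one⟩ ha)

theorem abs_weightPrim_sub_le (hW : AntitoneOn W (Set.Icc 0 1))
    (hW0 : ∀ x ∈ Set.Icc (0 : ℝ) 1, 0 ≤ W x) {a b : ℝ}
    (ha : a ∈ Set.Icc (0 : ℝ) 1) (hb : b ∈ Set.Icc (0 : ℝ) 1) :
    |weightPrim W b - weightPrim W a| ≤ W 0 * |b - a| := by
  rw [weightPrim_sub hW ha hb]
  rw [← Real.norm_eq_abs (∫ x in a..b, W x)]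
  refine intervalIntegral.norm_integral_le_of_norm_le_const fun x hx => ?_
  have hx' : x ∈ Set.Icc (0 : ℝ) 1 := Set.uIcc_subset_Icc ha hb (Set.uIoc_subset_uIcc hx)
  rw [Real.norm_eq_abs, abs_of_nonneg (hW0 x hx')]
  exact weight_le hW hx'

theorem weightPrim_monotoneOn (hW : AntitoneOn W (Set.Icc 0 1))
    (hW0 : ∀ x ∈ Set.Icc (0 : ℝ) 1, 0 ≤ W x) : MonotoneOn (weightPrim W) (Set.Icc 0 1) := by
  intro a ha b hb hab
  rw [← sub_nonneg, weightPrim_sub hW ha hb]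
  exact intervalIntegral.integral_nonneg hab fun x hx =>
    hW0 x ⟨ha.1.trans hx.1, hx.2.trans hb.2⟩

/-- The weights of the order statistics that are at most `x` add up to the primitive of `W` at the
empirical distribution function. -/
theorem sum_weight_sorted (hW : AntitoneOn W (Set.Icc 0 1)) {n : ℕ} (hn : 0 < n)
    (v : Fin n → ℝ) (x : ℝ) :
    ∑ j : Fin n, (∫ y in ((j : ℝ) / n)..(((j : ℝ) + 1) / n), W y) *
      (if v (Tuple.sort v j) ≤ x then (1 : ℝ) else 0) = weightPrim W (empCdf v x) := by
  set f : Fin n → ℝ := v ∘ Tuple.sort v with hf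
  set k := (Finset.univ.filter fun j => f j ≤ x).card with hk
  have hkn : k ≤ n := (Finset.card_le_univ _).trans (by simp)
  have hemp : empCdf v x = (k : ℝ) / n := by
    rw [empCdf, ← Equiv.sum_comp (Tuple.sort v) fun j => if v j ≤ x then (1 : ℝ) else 0, hk]
    simp [hf]
  have hn' : (0 : ℝ) < n := by exact_mod_cast hn
  have hmem : ∀ i : ℕ, i ≤ n → (i : ℝ) / n ∈ Set.Icc (0 : ℝ) 1 := fun i hi =>
    ⟨by positivity, div_le_one_of_le₀ (by exact_mod_cast hi) hn'.le⟩
  have hterm : ∀ j : Fin n, (∫ y in ((j : ℝ) / n)..(((j : ℝ) + 1) / n), W y) *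
      (if v (Tuple.sort v j) ≤ x then (1 : ℝ) else 0) =
      if (j : ℕ) < k then weightPrim W (((j + 1 : ℕ) : ℝ) / n) - weightPrim W ((j : ℝ) / n)
        else 0 := by
    intro j
    -- In the sorted sample the values at most `x` occupy exactly the first `k` ranks, so the sum
    -- runs over `j < k` and telescopes in the primitive.
    have := Tuple.lt_card_le_iff_apply_le_of_monotone (f := f) (a := x) (j := j) (Tuple.monotone_sort v)
    have h2 : (j : ℕ) < k ↔ v (Tuple.sort v j) ≤ x := this
    rw [weightPrim_sub hW (hmem _ j.2.le) (hmem _ j.2)]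
    by_cases h : v (Tuple.sort v j) ≤ x
    · simp [h, h2.2 h]
    · simp [h, mt h2.1 h]
  rw [Finset.sum_congr rfl fun j _ => hterm j, hemp,
    Fin.sum_univ_eq_sum_range (fun j => if j < k then
      weightPrim W (((j + 1 : ℕ) : ℝ) / n) - weightPrim W ((j : ℝ) / n) else 0) n,
    ← Finset.sum_filter]
  have : (Finset.range n).filter (· < k) = Finset.range k := by
    ext i; simp only [Finset.mem_filter, Finset.mem_range]; omega
  rw [this, Finset.sum_range_sub fun i : ℕ => weightPrim W ((i : ℝ) / n)]
  simp [weightPrim]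

theorem intervalIntegrable_weightPrim_comp (hW : AntitoneOn W (Set.Icc 0 1))
    (hW0 : ∀ x ∈ Set.Icc (0 : ℝ) 1, 0 ≤ W x) {F : ℝ → ℝ} (hF : Monotone F)
    (hF01 : ∀ x, F x ∈ Set.Icc (0 : ℝ) 1) (a b : ℝ) :
    IntervalIntegrable (fun x => weightPrim W (F x)) volume a b :=
  Monotone.intervalIntegrable fun x y hxy =>
    weightPrim_monotoneOn hW hW0 (hF01 x) (hF01 y) (hF hxy)

theorem empCdf_mem_Icc {n : ℕ} (v : Fin n → ℝ) (x : ℝ) : empCdf v x ∈ Set.Icc (0 : ℝ) 1 :=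
  ⟨empCdf_nonneg v x, empCdf_le_one v x⟩

/-- Summation by parts in integral form: each order statistic is replaced by its layer formula, and
at a level `x` the weights of those below `x` are collected by `sum_weight_sorted`. -/
theorem sortedMetric_eq (hW : AntitoneOn W (Set.Icc 0 1)) {n : ℕ} (hn : 0 < n) {C : ℝ}
    (v : Fin n → ℝ) (hv : ∀ j, |v j| ≤ C) :
    sortedMetric W n v =
      C * weightPrim W 1 - ∫ x in (-C)..C, weightPrim W (empCdf v x) := by
  have hn' : (0 : ℝ) < n := by exact_mod_cast hn
  set w : Fin n → ℝ := fun j => ∫ y in ((j : ℝ) / n)..(((j : ℝ) + 1) / n), W y with hw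
  have hsum : ∑ j, w j = weightPrim W 1 := by
    -- At a level above the whole sample, `sum_weight_sorted` gives the total weight.
    obtain ⟨x, hx⟩ := (Finset.univ.image v).exists_le
    have hx : ∀ j, v j ≤ x := fun j => hx _ (Finset.mem_image_of_mem _ (Finset.mem_univ _))
    have := sum_weight_sorted hW hn v x
    simp only [hx, if_true, mul_one] at this
    rw [this]
    congr 1
    simp [empCdf, hx, hn'.ne']
  have hsort : sortedMetric W n v = ∑ j, w j * v (Tuple.sort v j) := rfl
  rw [hsort]
  have h1 : ∀ j, w j * v (Tuple.sort v j) = C * w j -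
      ∫ x in (-C)..C, w j * (if v (Tuple.sort v j) ≤ x then (1 : ℝ) else 0) := by
    intro j
    rw [intervalIntegral.integral_const_mul, integral_ite_le (hv _)]
    ring
  rw [Finset.sum_congr rfl fun j _ => h1 j, Finset.sum_sub_distrib, ← Finset.mul_sum, hsum,
    ← intervalIntegral.integral_finsetSum
      fun j _ => (intervalIntegrable_ite_le _ _ _).const_mul _]
  simp_rw [hw, sum_weight_sorted hW hn v]

end Weight

theorem cdf_mem_Icc (ν : Measure ℝ) (x : ℝ) : cdf ν x ∈ Set.Icc (0 : ℝ) 1 :=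
  ⟨cdf_nonneg ν x, cdf_le_one ν x⟩

theorem weight_cdf_antitone (ν : Measure ℝ) {W : ℝ → ℝ} (hW : AntitoneOn W (Set.Icc 0 1)) :
    Antitone fun y => W (cdf ν y) :=
  fun y z hyz => hW (cdf_mem_Icc ν y) (cdf_mem_Icc ν z) (monotone_cdf ν hyz)

/-! ### The UOR metric as a functional of an atomless distribution function. -/

section AtomlessCdf

variable (ν : Measure ℝ) [IsProbabilityMeasure ν] [NullSingletonClass ν]

theorem continuous_cdf_of_noAtoms : Continuous (cdf ν) := by
  rw [continuous_iff_continuousAt]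
  intro x
  rw [(monotone_cdf ν).continuousAt_iff_leftLim_eq_rightLim, (cdf ν).rightLim_eq]
  refine le_antisymm ((monotone_cdf ν).leftLim_le le_rfl) ?_
  have h := (cdf ν).measure_singleton x
  rw [measure_cdf, measure_singleton] at h
  linarith [ENNReal.ofReal_eq_zero.1 h.symm]

/-- The distribution function of an atomless law is uniformly distributed. -/
theorem measure_cdf_le {u : ℝ} (hu : 0 ≤ u) {x : ℝ} (hx : u < cdf ν x) :
    ν {y | cdf ν y ≤ u} = ENNReal.ofReal u := by
  have hbdd : ∀ y, cdf ν y ≤ u → y ≤ x := by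
    intro y hy
    by_contra hc
    exact absurd ((monotone_cdf ν) (not_le.1 hc).le) (by linarith)
  apply le_antisymm
  · rcases Set.eq_empty_or_nonempty {y | cdf ν y ≤ u} with h | h
    · simp [h]
    -- By continuity the sublevel set contains its supremum, hence lies in a half-line of mass at
    -- most `u`.
    · have hmem : sSup {y | cdf ν y ≤ u} ∈ {y | cdf ν y ≤ u} :=
        (isClosed_le (continuous_cdf_of_noAtoms ν) continuous_const).csSup_mem h ⟨x, hbdd⟩
      calc ν {y | cdf ν y ≤ u} ≤ ν (Set.Iic (sSup {y | cdf ν y ≤ u})) :=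
            measure_mono fun y hy => le_csSup ⟨x, hbdd⟩ hy
        _ = ENNReal.ofReal (cdf ν (sSup {y | cdf ν y ≤ u})) := (ofReal_cdf ν _).symm
        _ ≤ ENNReal.ofReal u := ENNReal.ofReal_le_ofReal hmem
  · rcases hu.eq_or_lt with rfl | hu
    · simp
    -- The value `u` is attained at some `b`, and the half-line up to `b` has mass exactly `u`.
    · obtain ⟨a, ha⟩ := ((tendsto_cdf_atBot ν).eventually (gt_mem_nhds hu)).exists
      have hax : a ≤ x := hbdd a ha.le
      obtain ⟨b, -, hb⟩ := intermediate_value_Icc hax (continuous_cdf_of_noAtoms ν).continuousOn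
        ⟨ha.le, hx.le⟩
      rw [← hb, ofReal_cdf]
      exact measure_mono fun y hy => (monotone_cdf ν) hy

/-- The probability integral transform, localized to a half-line so that a change of variables
produces the primitive of `W` at `cdf ν x`. It suffices to compare the two finite measures on
half-lines. -/
theorem map_cdf_restrict_Iic (x : ℝ) :
    (ν.restrict (Set.Iic x)).map (cdf ν) = volume.restrict (Set.Icc 0 (cdf ν x)) := by
  have hmeas : Measurable (cdf ν) := (monotone_cdf ν).measurable
  refine Measure.ext_of_Iic _ _ fun u => ?_
  rw [Measure.map_apply hmeas measurableSet_Iic, Measure.restrict_apply (hmeas measurableSet_Iic),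
    Measure.restrict_apply measurableSet_Iic]
  rcases lt_or_ge u 0 with hu | hu
  · have h1 : cdf ν ⁻¹' Set.Iic u = ∅ := by
      ext y; simpa using hu.trans_le (cdf_nonneg ν y)
    have h2 : Set.Iic u ∩ Set.Icc 0 (cdf ν x) = ∅ := by
      ext y; simp only [Set.mem_inter_iff, Set.mem_Iic, Set.mem_Icc, Set.mem_empty_iff_false,
        iff_false]
      rintro ⟨h, h', -⟩; linarith
    simp [h1, h2]
  have h2 : Set.Iic u ∩ Set.Icc 0 (cdf ν x) = Set.Icc 0 (min u (cdf ν x)) := by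
    ext y; simp only [Set.mem_inter_iff, Set.mem_Iic, Set.mem_Icc, le_min_iff]; tauto
  rw [h2, Real.volume_Icc, sub_zero]
  rcases lt_or_ge u (cdf ν x) with h | h
  · rw [min_eq_left h.le, ← measure_cdf_le ν hu h]
    congr 1
    ext y
    simp only [Set.mem_inter_iff, Set.mem_preimage, Set.mem_Iic, Set.mem_ofPred_eq,
      and_iff_left_iff_imp]
    intro hy
    by_contra hc
    exact absurd ((monotone_cdf ν) (not_le.1 hc).le) (by linarith)
  · rw [min_eq_right h, ofReal_cdf]
    congr 1
    ext y
    simp only [Set.mem_inter_iff, Set.mem_preimage, Set.mem_Iic, and_iff_right_iff_imp]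
    intro hy
    exact ((monotone_cdf ν) hy).trans h

variable {W : ℝ → ℝ}

theorem setIntegral_weight_cdf (hW : AntitoneOn W (Set.Icc 0 1)) (x : ℝ) :
    ∫ y in Set.Iic x, W (cdf ν y) ∂ν = weightPrim W (cdf ν x) := by
  have hmeas : Measurable (cdf ν) := (monotone_cdf ν).measurable
  have hint := weight_intervalIntegrable hW ⟨le_rfl, zero_le_one⟩ (cdf_mem_Icc ν x)
  rw [intervalIntegrable_iff_integrableOn_Icc_of_le (cdf_nonneg ν x)] at hint
  -- `W` is monotone only on `[0, 1]`, so its measurability is available only for the image measure,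
  -- which lives there.
  have h := integral_map (μ := ν.restrict (Set.Iic x)) hmeas.aemeasurable (f := W)
    (by rw [map_cdf_restrict_Iic]; exact hint.aestronglyMeasurable)
  rw [← h, map_cdf_restrict_Iic, weightPrim, intervalIntegral.integral_of_le (cdf_nonneg ν x),
    integral_Icc_eq_integral_Ioc]

/-- The continuous counterpart of `sortedMetric_eq`: insert the layer formula for `y`, exchange the
integrals, and evaluate the inner one by `setIntegral_weight_cdf`. -/
theorem integral_mul_weight_cdf (hW : AntitoneOn W (Set.Icc 0 1))
    (hW0 : ∀ x ∈ Set.Icc (0 : ℝ) 1, 0 ≤ W x) {C : ℝ} (hC : 0 ≤ C) (hν : ∀ᵐ y ∂ν, |y| ≤ C) :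
    ∫ y, y * W (cdf ν y) ∂ν = C * weightPrim W 1 - ∫ x in (-C)..C, weightPrim W (cdf ν x) := by
  have hWm : Measurable fun y => W (cdf ν y) := (weight_cdf_antitone ν hW).measurable
  have hWb : ∀ y, |W (cdf ν y)| ≤ W 0 := fun y => by
    rw [abs_of_nonneg (hW0 _ (cdf_mem_Icc ν y))]; exact weight_le hW (cdf_mem_Icc ν y)
  have hWi : Integrable (fun y => W (cdf ν y)) ν :=
    Integrable.of_bound hWm.aestronglyMeasurable (W 0) (.of_forall hWb)
  have htotal : ∫ y, W (cdf ν y) ∂ν = weightPrim W 1 := by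
    have hC1 : ν (Set.Iic C) = 1 := by
      rw [← mem_ae_iff_prob_eq_one measurableSet_Iic]
      filter_upwards [hν] with y hy using (abs_le.1 hy).2
    have : cdf ν C = 1 := by rw [cdf_eq_real, measureReal_def, hC1]; simp
    rw [← this, ← setIntegral_weight_cdf ν hW C, setIntegral_eq_integral_of_ae_compl_eq_zero]
    filter_upwards [hν] with y hy hc
    exact absurd (abs_le.1 hy).2 hc
  have hpt : ∀ᵐ y ∂ν, y * W (cdf ν y) = C * W (cdf ν y) -
      ∫ x in Set.Ioc (-C) C, (if y ≤ x then (1 : ℝ) else 0) * W (cdf ν y) := by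
    filter_upwards [hν] with y hy
    rw [integral_mul_const, ← intervalIntegral.integral_of_le (by linarith), integral_ite_le hy]
    ring
  have hfub : Integrable (Function.uncurry fun y x : ℝ =>
      (if y ≤ x then (1 : ℝ) else 0) * W (cdf ν y)) (ν.prod (volume.restrict (Set.Ioc (-C) C))) := by
    refine Integrable.of_bound (C := W 0) ?_ (.of_forall ?_)
    · refine Measurable.aestronglyMeasurable ?_
      exact (Measurable.ite (measurableSet_le measurable_fst measurable_snd) measurable_const
        measurable_const).mul (hWm.comp measurable_fst)
    · rintro ⟨y, x⟩
      simp only [Function.uncurry_apply_pair, norm_mul]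
      calc _ ≤ 1 * W 0 := by
            refine mul_le_mul ?_ (hWb y) (norm_nonneg _) zero_le_one
            split_ifs <;> simp
        _ = W 0 := one_mul _
  have hfub' : Integrable (fun y => ∫ x in Set.Ioc (-C) C,
      (if y ≤ x then (1 : ℝ) else 0) * W (cdf ν y)) ν := hfub.integral_prod_left
  rw [integral_congr_ae hpt, integral_sub (hWi.const_mul C) hfub',
    integral_const_mul, htotal, integral_integral_swap hfub,
    intervalIntegral.integral_of_le (by linarith)]
  congr 1
  refine integral_congr_ae (.of_forall fun x => ?_)
  dsimp only
  rw [← setIntegral_weight_cdf ν hW x, ← integral_indicator measurableSet_Iic]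
  refine integral_congr_ae (.of_forall fun y => ?_)
  by_cases h : y ≤ x <;> simp [h]

/-- An `L`-statistic deviates from its theoretical counterpart by at most the `L¹`-distance of the
distribution functions. -/
theorem abs_sortedMetric_sub_le (hW : AntitoneOn W (Set.Icc 0 1))
    (hW0 : ∀ x ∈ Set.Icc (0 : ℝ) 1, 0 ≤ W x) {C : ℝ} (hC : 0 ≤ C) (hν : ∀ᵐ y ∂ν, |y| ≤ C)
    {n : ℕ} (hn : 0 < n) (v : Fin n → ℝ) (hv : ∀ j, |v j| ≤ C) :
    |sortedMetric W n v - ∫ y, y * W (cdf ν y) ∂ν| ≤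
      W 0 * ∫ x in (-C)..C, |empCdf v x - cdf ν x| := by
  have hi1 := intervalIntegrable_weightPrim_comp hW hW0 (monotone_cdf ν) (cdf_mem_Icc ν) (-C) C
  have hi2 := intervalIntegrable_weightPrim_comp hW hW0 (empCdf_mono v) (empCdf_mem_Icc v) (-C) C
  rw [sortedMetric_eq hW hn v hv, integral_mul_weight_cdf ν hW hW0 hC hν, sub_sub_sub_cancel_left,
    ← intervalIntegral.integral_sub hi1 hi2, ← intervalIntegral.integral_const_mul]
  refine (intervalIntegral.abs_integral_le_integral_abs (by linarith)).trans ?_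
  refine intervalIntegral.integral_mono_on (by linarith) (hi1.sub hi2).abs ?_ fun x _ => ?_
  · exact (((empCdf_mono v).intervalIntegrable.sub
      (monotone_cdf ν).intervalIntegrable).abs).const_mul _
  · rw [abs_sub_comm (empCdf v x)]
    exact abs_weightPrim_sub_le hW hW0 (empCdf_mem_Icc v x) (cdf_mem_Icc ν x)

end AtomlessCdf

/-! ### Exponential moments -/

/-- The exponential moments of `X` are bounded like those of a Gaussian variable, up to a
constant factor `A`. -/
def ExpMomentBound {Ω : Type*} [MeasurableSpace Ω] (μ : Measure Ω) (X : Ω → ℝ) (A σ : ℝ) : Prop :=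
  ∀ l : ℝ, ∫⁻ ω, ENNReal.ofReal (Real.exp (l * X ω)) ∂μ ≤
    ENNReal.ofReal (A * Real.exp (σ * l ^ 2))

/-- By convexity the exponential lies below its chord over `[-lK, lK]`. The bound is affine in `y`,
so for a conditionally centred `y` only the `cosh` term survives. -/
theorem exp_le_cosh_add_sinh {K y : ℝ} (hK : 0 < K) (hy : |y| ≤ K) (l : ℝ) :
    Real.exp (l * y) ≤ Real.cosh (l * K) + y * (Real.sinh (l * K) / K) := by
  obtain ⟨h1, h2⟩ := abs_le.1 hy
  have ha : 0 ≤ (K + y) / (2 * K) := div_nonneg (by linarith) (by linarith)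
  have hb : 0 ≤ (K - y) / (2 * K) := div_nonneg (by linarith) (by linarith)
  have h := convexOn_exp.2 (Set.mem_univ (l * K)) (Set.mem_univ (-(l * K))) ha hb
    (by field_simp; ring)
  have e1 : ((K + y) / (2 * K)) • (l * K) + ((K - y) / (2 * K)) • (-(l * K)) = l * y := by
    simp only [smul_eq_mul]; field_simp; ring
  rw [e1] at h
  refine h.trans_eq ?_
  rw [Real.cosh_eq, Real.sinh_eq, smul_eq_mul, smul_eq_mul]
  field_simp
  ring

section Azuma

variable {Ω : Type*} [mΩ : MeasurableSpace Ω] (μ : Measure Ω) [IsProbabilityMeasure μ]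

/-- Exponential moments of a sum of bounded martingale differences. -/
theorem integral_exp_sum_le (ℱ : ℕ → MeasurableSpace Ω) (Y : ℕ → Ω → ℝ) {K : ℝ} (hK : 0 < K)
    (N : ℕ) (hle : ∀ k < N, ℱ k ≤ mΩ) (hmeas : ∀ k < N, StronglyMeasurable (Y k))
    (hadapt : ∀ k < N, ∀ i < k, StronglyMeasurable[ℱ k] (Y i))
    (hb : ∀ k < N, ∀ᵐ ω ∂μ, |Y k ω| ≤ K) (h0 : ∀ k < N, μ[Y k|ℱ k] =ᵐ[μ] 0) (l : ℝ) :
    Integrable (fun ω => Real.exp (l * ∑ k ∈ Finset.range N, Y k ω)) μ ∧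
    ∫ ω, Real.exp (l * ∑ k ∈ Finset.range N, Y k ω) ∂μ ≤ Real.exp (N * (l ^ 2 * K ^ 2 / 2)) := by
  induction N with
  | zero => simp
  | succ N ih =>
    obtain ⟨ihi, ih⟩ := ih (fun k hk => hle k (by omega)) (fun k hk => hmeas k (by omega))
      (fun k hk => hadapt k (by omega)) (fun k hk => hb k (by omega)) (fun k hk => h0 k (by omega))
    set E : Ω → ℝ := fun ω => Real.exp (l * ∑ k ∈ Finset.range N, Y k ω) with hE
    -- Monotonicity of `ℱ` is not assumed; it is enough that each `ℱ N` knows all earlier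
    -- differences.
    have hEm : StronglyMeasurable[ℱ N] E := by
      refine Real.continuous_exp.comp_stronglyMeasurable (StronglyMeasurable.const_mul ?_ l)
      exact Finset.stronglyMeasurable_fun_sum _ fun k hk =>
        hadapt N (by omega) k (Finset.mem_range.1 hk)
    have hYb := hb N (by omega)
    have hYi : Integrable (Y N) μ :=
      Integrable.of_bound (hmeas N (by omega)).aestronglyMeasurable K hYb
    have hEYi : Integrable (fun ω => E ω * Y N ω) μ :=
      ihi.mul_bdd (c := K) (hmeas N (by omega)).aestronglyMeasurable hYb
    -- The past factor can be pulled out of the conditional expectation, and the martingale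
    -- difference then vanishes.
    have hEY : ∫ ω, E ω * Y N ω ∂μ = 0 := by
      rw [← integral_condExp (hle N (by omega))]
      have := condExp_mul_of_stronglyMeasurable_left hEm hEYi hYi
      rw [integral_congr_ae (g := 0)]
      · simp
      · refine (this.trans ?_)
        filter_upwards [h0 N (by omega)] with ω hω
        simp [hω]
    have hsucc : ∀ ω, Real.exp (l * ∑ k ∈ Finset.range (N + 1), Y k ω) =
        E ω * Real.exp (l * Y N ω) := fun ω => by
      rw [Finset.sum_range_succ, mul_add, Real.exp_add]
    have hle' : ∀ᵐ ω ∂μ, Real.exp (l * ∑ k ∈ Finset.range (N + 1), Y k ω) ≤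
        Real.cosh (l * K) * E ω + (Real.sinh (l * K) / K) * (E ω * Y N ω) := by
      filter_upwards [hYb] with ω hω
      rw [hsucc]
      calc E ω * Real.exp (l * Y N ω)
          ≤ E ω * (Real.cosh (l * K) + Y N ω * (Real.sinh (l * K) / K)) :=
            mul_le_mul_of_nonneg_left (exp_le_cosh_add_sinh hK hω l) (Real.exp_pos _).le
        _ = _ := by ring
    have hint := (ihi.const_mul (Real.cosh (l * K))).add
      (hEYi.const_mul (Real.sinh (l * K) / K))
    have hi : Integrable (fun ω => Real.exp (l * ∑ k ∈ Finset.range (N + 1), Y k ω)) μ := by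
      refine hint.mono' ?_ ?_
      · refine Real.continuous_exp.comp_aestronglyMeasurable (AEStronglyMeasurable.const_mul ?_ l)
        exact (Finset.stronglyMeasurable_fun_sum _ fun k hk =>
          hmeas k (Finset.mem_range.1 hk)).aestronglyMeasurable
      · filter_upwards [hle'] with ω hω
        rwa [Real.norm_eq_abs, Real.abs_exp]
    refine ⟨hi, ?_⟩
    calc _ ≤ ∫ ω, (Real.cosh (l * K) * E ω + (Real.sinh (l * K) / K) * (E ω * Y N ω)) ∂μ :=
          integral_mono_ae hi hint hle'
      _ = Real.cosh (l * K) * ∫ ω, E ω ∂μ := by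
          rw [integral_add (ihi.const_mul _) (hEYi.const_mul _), integral_const_mul,
            integral_const_mul, hEY]
          ring
      _ ≤ Real.exp ((l * K) ^ 2 / 2) * Real.exp (N * (l ^ 2 * K ^ 2 / 2)) :=
          mul_le_mul (Real.cosh_le_exp_half_sq _) ih (integral_nonneg fun ω => (Real.exp_pos _).le)
            (Real.exp_pos _).le
      _ = _ := by
          rw [← Real.exp_add]
          congr 1
          push_cast
          ring

/-- **Azuma's inequality** in terms of exponential moments. -/
theorem expMomentBound_sum (ℱ : ℕ → MeasurableSpace Ω) (Y : ℕ → Ω → ℝ) {K : ℝ} (hK : 0 < K)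
    (N : ℕ) (hle : ∀ k < N, ℱ k ≤ mΩ) (hmeas : ∀ k < N, StronglyMeasurable (Y k))
    (hadapt : ∀ k < N, ∀ i < k, StronglyMeasurable[ℱ k] (Y i))
    (hb : ∀ k < N, ∀ᵐ ω ∂μ, |Y k ω| ≤ K) (h0 : ∀ k < N, μ[Y k|ℱ k] =ᵐ[μ] 0) :
    ExpMomentBound μ (fun ω => ∑ k ∈ Finset.range N, Y k ω) 1 (N * K ^ 2 / 2) := by
  intro l
  obtain ⟨hi, h⟩ := integral_exp_sum_le μ ℱ Y hK N hle hmeas hadapt hb h0 l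
  rw [← ofReal_integral_eq_lintegral_ofReal hi (.of_forall fun ω => (Real.exp_pos _).le)]
  refine ENNReal.ofReal_le_ofReal (h.trans_eq ?_)
  rw [one_mul]
  congr 1
  ring

end Azuma

theorem ExpMomentBound.div_const {Ω : Type*} [MeasurableSpace Ω] {μ : Measure Ω} {X : Ω → ℝ}
    {A σ : ℝ} (h : ExpMomentBound μ X A σ) (c : ℝ) :
    ExpMomentBound μ (fun ω => X ω / c) A (σ / c ^ 2) := by
  intro l
  have := h (l / c)
  rw [div_pow] at this
  convert this using 4 <;> ring_nf

/-- Since `lZ ≤ 1/2 + (lZ)² / 2`, a bounded summand, even if not centred and not independent, costs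
only a factor `e^{1/2}` and `K ^ 2 / 2` in the exponent. It serves for the starting value of a Doob
martingale. -/
theorem ExpMomentBound.add_bounded {Ω : Type*} [MeasurableSpace Ω] {μ : Measure Ω} {X Z : Ω → ℝ}
    {A σ K : ℝ} (h : ExpMomentBound μ X A σ) (hZ : ∀ᵐ ω ∂μ, |Z ω| ≤ K) :
    ExpMomentBound μ (fun ω => X ω + Z ω) (Real.exp (1 / 2) * A) (σ + K ^ 2 / 2) := by
  intro l
  calc ∫⁻ ω, ENNReal.ofReal (Real.exp (l * (X ω + Z ω))) ∂μ
      ≤ ∫⁻ ω, ENNReal.ofReal (Real.exp (1 / 2 + K ^ 2 / 2 * l ^ 2)) *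
          ENNReal.ofReal (Real.exp (l * X ω)) ∂μ := by
        refine lintegral_mono_ae ?_
        filter_upwards [hZ] with ω hω
        rw [← ENNReal.ofReal_mul (Real.exp_pos _).le, ← Real.exp_add]
        refine ENNReal.ofReal_le_ofReal (Real.exp_le_exp.2 ?_)
        have h2 : Z ω ^ 2 ≤ K ^ 2 := sq_le_sq' (abs_le.1 hω).1 (abs_le.1 hω).2
        nlinarith [sq_nonneg (l * Z ω - 1), mul_le_mul_of_nonneg_left h2 (sq_nonneg l)]
    _ ≤ ENNReal.ofReal (Real.exp (1 / 2 + K ^ 2 / 2 * l ^ 2)) *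
          ENNReal.ofReal (A * Real.exp (σ * l ^ 2)) := by
        rw [lintegral_const_mul' _ _ ENNReal.ofReal_ne_top]
        gcongr
        exact h l
    _ = _ := by
        rw [← ENNReal.ofReal_mul (Real.exp_pos _).le, Real.exp_add, add_mul, Real.exp_add]
        congr 1
        ring

/-- If all the variables `X a` have Gaussian exponential moments, then so does the average of their
absolute values, with no loss in the number of variables. -/
theorem measure_le_integral_abs_le {Ω ι : Type*} [MeasurableSpace Ω] [MeasurableSpace ι]
    (μ : Measure Ω) [SFinite μ] (ν : Measure ι) [IsProbabilityMeasure ν] (X : ι → Ω → ℝ)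
    (hX : Measurable (Function.uncurry X)) {K : ℝ} (hK : ∀ a ω, |X a ω| ≤ K) {A σ : ℝ} (hσ : 0 < σ)
    (h : ∀ᵐ a ∂ν, ExpMomentBound μ (X a) A σ) {t : ℝ} (ht : 0 ≤ t) :
    μ {ω | t ≤ ∫ a, |X a ω| ∂ν} ≤ ENNReal.ofReal (2 * A * Real.exp (-(t ^ 2 / (4 * σ)))) := by
  -- The minimizer of the Chernoff exponent `σ l² - l t`.
  set l : ℝ := t / (2 * σ) with hl
  have hl0 : 0 ≤ l := by positivity
  set G : Ω → ℝ≥0∞ := fun ω => ∫⁻ a, ENNReal.ofReal (Real.exp (l * |X a ω|)) ∂ν with hG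
  have hjm : Measurable (Function.uncurry fun a ω => ENNReal.ofReal (Real.exp (l * |X a ω|))) :=
    (Real.measurable_exp.comp ((measurable_norm.comp hX).const_mul l)).ennreal_ofReal
  have hGm : Measurable G := hjm.lintegral_prod_left
  have hXa : ∀ ω, Measurable fun a => X a ω := fun ω => hX.comp measurable_prodMk_right
  have hXw : ∀ a, Measurable (X a) := fun a => hX.comp measurable_prodMk_left
  -- Jensen bounds the exponential of the average by the average of exponentials, whose expectation
  -- is computed separately for each `a` by Fubini.
  have hjensen : ∀ ω, ENNReal.ofReal (Real.exp (l * ∫ a, |X a ω| ∂ν)) ≤ G ω := by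
    intro ω
    have habs : Measurable fun a => l * |X a ω| := (measurable_norm.comp (hXa ω)).const_mul l
    have hi1 : Integrable (fun a => l * |X a ω|) ν := by
      refine Integrable.of_bound habs.aestronglyMeasurable (l * K) (.of_forall fun a => ?_)
      rw [Real.norm_eq_abs, abs_mul, abs_abs, abs_of_nonneg hl0]
      exact mul_le_mul_of_nonneg_left (hK a ω) hl0
    have hi2 : Integrable (fun a => Real.exp (l * |X a ω|)) ν := by
      refine Integrable.of_bound (Real.measurable_exp.comp habs).aestronglyMeasurable
        (Real.exp (l * K)) (.of_forall fun a => ?_)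
      rw [Real.norm_eq_abs, Real.abs_exp]
      exact Real.exp_le_exp.2 (mul_le_mul_of_nonneg_left (hK a ω) hl0)
    rw [hG]
    dsimp only
    rw [← ofReal_integral_eq_lintegral_ofReal hi2 (.of_forall fun ω => (Real.exp_pos _).le),
      ← integral_const_mul]
    exact ENNReal.ofReal_le_ofReal (convexOn_exp.map_integral_le Real.continuous_exp.continuousOn
      isClosed_univ (.of_forall fun _ => Set.mem_univ _) hi1 hi2)
  have habs : ∀ a, ExpMomentBound μ (X a) A σ →
      ∫⁻ ω, ENNReal.ofReal (Real.exp (l * |X a ω|)) ∂μ ≤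
        ENNReal.ofReal (2 * A * Real.exp (σ * l ^ 2)) := by
    intro a ha
    calc ∫⁻ ω, ENNReal.ofReal (Real.exp (l * |X a ω|)) ∂μ
        -- The absolute value is removed by `e^{l|x|} ≤ e^{lx} + e^{-lx}`, the source of the factor
        -- `2`.
        ≤ ∫⁻ ω, (ENNReal.ofReal (Real.exp (l * X a ω)) +
            ENNReal.ofReal (Real.exp (-l * X a ω))) ∂μ := by
          refine lintegral_mono fun ω => ?_
          rcases abs_cases (X a ω) with ⟨h, -⟩ | ⟨h, -⟩
          · rw [h]; exact le_self_add
          · rw [h, mul_neg, ← neg_mul]; exact le_add_self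
      _ ≤ ENNReal.ofReal (A * Real.exp (σ * l ^ 2)) +
            ENNReal.ofReal (A * Real.exp (σ * (-l) ^ 2)) := by
          have hm : Measurable fun ω => ENNReal.ofReal (Real.exp (l * X a ω)) :=
            (Real.measurable_exp.comp ((hXw a).const_mul l)).ennreal_ofReal
          rw [lintegral_add_left hm]
          exact add_le_add (ha l) (ha (-l))
      _ = ENNReal.ofReal (2 * A * Real.exp (σ * l ^ 2)) := by
          rw [neg_sq, ← two_mul, mul_assoc, ENNReal.ofReal_mul zero_le_two]
          simp
  have hGint : ∫⁻ ω, G ω ∂μ ≤ ENNReal.ofReal (2 * A * Real.exp (σ * l ^ 2)) := by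
    rw [hG, ← lintegral_lintegral_swap hjm.aemeasurable]
    calc _ ≤ ∫⁻ _a, ENNReal.ofReal (2 * A * Real.exp (σ * l ^ 2)) ∂ν :=
          lintegral_mono_ae (h.mono habs)
      _ = _ := by simp
  have hpos : ENNReal.ofReal (Real.exp (l * t)) ≠ 0 := by simp [Real.exp_pos]
  calc μ {ω | t ≤ ∫ a, |X a ω| ∂ν}
      ≤ μ {ω | ENNReal.ofReal (Real.exp (l * t)) ≤ G ω} := by
        refine measure_mono fun ω hω => le_trans (ENNReal.ofReal_le_ofReal ?_) (hjensen ω)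
        exact Real.exp_le_exp.2 (mul_le_mul_of_nonneg_left hω hl0)
    _ ≤ (∫⁻ ω, G ω ∂μ) / ENNReal.ofReal (Real.exp (l * t)) :=
        meas_ge_le_lintegral_div hGm.aemeasurable hpos ENNReal.ofReal_ne_top
    _ ≤ ENNReal.ofReal (2 * A * Real.exp (σ * l ^ 2)) / ENNReal.ofReal (Real.exp (l * t)) :=
        ENNReal.div_le_div_right hGint _
    _ = ENNReal.ofReal (2 * A * Real.exp (-(t ^ 2 / (4 * σ)))) := by
        rw [← ENNReal.ofReal_div_of_pos (Real.exp_pos _), mul_div_assoc, ← Real.exp_sub]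
        congr 3
        rw [hl]; field_simp; ring

/-! ### Total variation distance and conditional laws -/

theorem abs_integral_le_of_abs_le {X : Type*} [MeasurableSpace X] (μ : Measure X)
    [IsProbabilityMeasure μ] {f : X → ℝ} {K : ℝ} (hK : ∀ x, |f x| ≤ K) : |∫ x, f x ∂μ| ≤ K := by
  have := norm_integral_le_of_norm_le_const (f := f) (μ := μ) (C := K) (.of_forall hK)
  rwa [probReal_univ, mul_one] at this

section TV

variable {X : Type*} [MeasurableSpace X] (μ ν : Measure X) [IsProbabilityMeasure μ]
  [IsProbabilityMeasure ν]

theorem abs_measureReal_sub_le_tv {B : Set X} (hB : MeasurableSet B) :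
    |μ.real B - ν.real B| ≤ tv μ ν := by
  refine le_ciSup (f := fun B : {B : Set X // MeasurableSet B} => |μ.real B.1 - ν.real B.1|)
    ⟨1, ?_⟩ ⟨B, hB⟩
  rintro _ ⟨C, rfl⟩
  exact abs_sub_le_of_nonneg_of_le measureReal_nonneg measureReal_le_one measureReal_nonneg
    measureReal_le_one

theorem tv_nonneg : 0 ≤ tv μ ν :=
  (abs_nonneg _).trans (abs_measureReal_sub_le_tv μ ν MeasurableSet.empty)

/-- By the layer cake formula for `f + K`, which takes values in `[0, 2K]`, the difference is an
integral over levels in `(0, 2K]` of differences of measures of one superlevel set. -/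
theorem abs_integral_sub_le_tv {f : X → ℝ} (hf : Measurable f) {K : ℝ} (hK : ∀ x, |f x| ≤ K) :
    |∫ x, f x ∂μ - ∫ x, f x ∂ν| ≤ 2 * K * tv μ ν := by
  obtain ⟨x₀⟩ : Nonempty X := nonempty_of_isProbabilityMeasure μ
  have hK0 : 0 ≤ K := (abs_nonneg _).trans (hK x₀)
  have hlc : ∀ (ρ : Measure X) [IsProbabilityMeasure ρ],
      ∫ x, f x ∂ρ + K = ∫ t in Set.Ioc 0 (2 * K), ρ.real {x | t ≤ f x + K} := by
    intro ρ _
    have hi : Integrable f ρ := Integrable.of_bound hf.aestronglyMeasurable K (.of_forall hK)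
    rw [← Integrable.integral_eq_integral_Ioc_meas_le (f := fun x => f x + K)
      (hi.add (integrable_const K)) (.of_forall fun x => ?_) (.of_forall fun x => ?_),
      integral_add hi (integrable_const K)]
    · simp
    · have := (abs_le.1 (hK x)).1
      simp only [Pi.zero_apply]; linarith
    · have := (abs_le.1 (hK x)).2
      dsimp only; linarith
  have hint : ∀ (ρ : Measure X) [IsProbabilityMeasure ρ],
      IntegrableOn (fun t => ρ.real {x | t ≤ f x + K}) (Set.Ioc 0 (2 * K)) := by
    intro ρ _
    have hanti : Antitone fun t => ρ.real {x | t ≤ f x + K} := fun s t hst =>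
      measureReal_mono fun x (hx : t ≤ f x + K) => hst.trans hx
    exact (intervalIntegrable_iff_integrableOn_Ioc_of_le (by linarith)).1
      hanti.intervalIntegrable
  have e : ∫ x, f x ∂μ - ∫ x, f x ∂ν = ∫ t in Set.Ioc 0 (2 * K),
      (μ.real {x | t ≤ f x + K} - ν.real {x | t ≤ f x + K}) := by
    rw [integral_sub (hint μ) (hint ν), ← hlc μ, ← hlc ν]
    ring
  rw [e, ← Real.norm_eq_abs]
  refine (norm_setIntegral_le_of_norm_le_const (C := tv μ ν)
    measure_Ioc_lt_top fun t _ => ?_).trans ?_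
  · exact abs_measureReal_sub_le_tv μ ν (measurableSet_le measurable_const (hf.add_const K))
  · rw [Real.volume_real_Ioc_of_le (by linarith), sub_zero, mul_comm]

end TV

section CondLaw

variable {Ω X Z : Type*} {m : MeasurableSpace Ω} [mΩ : MeasurableSpace Ω] [MeasurableSpace X]
  [MeasurableSpace Z] {μ : Measure Ω} [IsProbabilityMeasure μ] {Y : Ω → X}

theorem IsCondLaw.setIntegral_eq {Q : Ω → Measure X} (h : IsCondLaw μ m Y Q) (hm : m ≤ mΩ)
    (hY : Measurable Y) {s : Set Ω} (hs : MeasurableSet[m] s) {B : Set X} (hB : MeasurableSet B) :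
    ∫ ω in s, (Q ω).real B ∂μ = μ.real (s ∩ Y ⁻¹' B) := by
  have hYB : MeasurableSet (Y ⁻¹' B) := hY hB
  rw [setIntegral_congr_ae (g := μ⟦Y ⁻¹' B | m⟧) (hm _ hs)
    ((h.2 B hB).symm.mono fun ω hω _ => hω),
    setIntegral_condExp hm ((integrable_const (1 : ℝ)).indicator hYB) hs,
    setIntegral_indicator hYB]
  simp

/-- Transfers the almost sure reward bound from the trajectory kernel to the trajectories of a run.
-/
theorem IsCondLaw.ae_mem {Q : Ω → Measure X} (h : IsCondLaw μ m Y Q) (hm : m ≤ mΩ)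
    (hY : Measurable Y) {B : Set X} (hB : MeasurableSet B) (hQ : ∀ ω, ∀ᵐ x ∂(Q ω), x ∈ B) :
    ∀ᵐ ω ∂μ, Y ω ∈ B := by
  have hQ1 : ∀ ω, (Q ω).real B = 1 := fun ω => by
    have := h.1 ω
    rw [measureReal_def, (mem_ae_iff_prob_eq_one hB).1 (hQ ω)]; simp
  have h1 := h.setIntegral_eq hm hY MeasurableSet.univ hB
  simp only [hQ1, Measure.restrict_univ, integral_const, probReal_univ, Set.univ_inter,
    smul_eq_mul, mul_one] at h1
  have h2 : μ (Y ⁻¹' B) = 1 := by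
    rw [measureReal_def] at h1
    rw [← ENNReal.ofReal_toReal (measure_ne_top μ (Y ⁻¹' B)), ← h1, ENNReal.ofReal_one]
  exact (mem_ae_iff_prob_eq_one (hY hB)).2 h2

/-- Conditional expectation of a bounded function of a random element whose conditional law is given
by a kernel. -/
theorem condExp_comp_of_isCondLaw (κ : Kernel Z X) [IsMarkovKernel κ] {φ : Ω → Z}
    (hφ : Measurable[m] φ) (hm : m ≤ mΩ) (hY : Measurable Y)
    (h : IsCondLaw μ m Y fun ω => κ (φ ω)) {g : X → ℝ} (hg : Measurable g) {K : ℝ}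
    (hK : ∀ x, |g x| ≤ K) :
    μ[fun ω => g (Y ω)|m] =ᵐ[μ] fun ω => ∫ x, g x ∂(κ (φ ω)) := by
  have hφ' : Measurable φ := hφ.mono hm le_rfl
  have hGm : StronglyMeasurable fun z => ∫ x, g x ∂(κ z) :=
    StronglyMeasurable.integral_kernel hg.stronglyMeasurable
  have hGb : ∀ z, ‖∫ x, g x ∂(κ z)‖ ≤ K := fun z =>
    abs_integral_le_of_abs_le _ hK
  have hGi : Integrable (fun ω => ∫ x, g x ∂(κ (φ ω))) μ :=
    Integrable.of_bound (hGm.comp_measurable hφ').aestronglyMeasurable K (.of_forall fun ω => hGb _)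
  have hgi : Integrable (fun ω => g (Y ω)) μ :=
    Integrable.of_bound (hg.comp hY).aestronglyMeasurable K (.of_forall fun ω => hK _)
  symm
  refine ae_eq_condExp_of_forall_setIntegral_eq hm hgi (fun s _ _ => hGi.integrableOn)
    (fun s hs _ => ?_) (hGm.comp_measurable hφ).aestronglyMeasurable
  -- On an event `s` of the past, mixing the kernel over `μ` restricted to `s` reproduces the law of
  -- `Y` there; this reduces integrals of `g` to the case of sets.
  have hmeas : ((κ.comap φ hφ') ∘ₖ Kernel.const Unit (μ.restrict s)) () =
      (μ.restrict s).map Y := by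
    ext B hB
    rw [Kernel.comp_apply' _ _ _ hB, Kernel.const_apply, Measure.map_apply hY hB,
      Measure.restrict_apply (hY hB)]
    have h1 := h.setIntegral_eq hm hY hs hB
    have h2 : ∀ ω, (κ.comap φ hφ') ω B = ENNReal.ofReal ((κ (φ ω)).real B) := fun ω => by
      rw [Kernel.comap_apply, ofReal_measureReal]
    simp_rw [h2]
    rw [← ofReal_integral_eq_lintegral_ofReal _ (.of_forall fun ω => measureReal_nonneg), h1,
      ofReal_measureReal, Set.inter_comm]
    refine Integrable.of_bound ?_ 1 (.of_forall fun ω => ?_)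
    · exact ((Kernel.measurable_coe κ hB).ennreal_toReal.comp hφ').aestronglyMeasurable
    · rw [Real.norm_eq_abs, abs_of_nonneg measureReal_nonneg]; exact measureReal_le_one
  have hi : Integrable g (((κ.comap φ hφ') ∘ₖ Kernel.const Unit (μ.restrict s)) ()) := by
    rw [hmeas]
    exact Integrable.of_bound hg.aestronglyMeasurable K (.of_forall hK)
  have := Kernel.integral_comp hi
  rw [hmeas, integral_map hY.aemeasurable hg.aestronglyMeasurable] at this
  simpa using this.symm

/-- Joint conditional law of an observed and an unobserved random element. -/
theorem IsCondLaw.condExp_prodMk {Q : Ω → Measure X} (h : IsCondLaw μ m Y Q) (hm : m ≤ mΩ)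
    (hY : Measurable Y) {φ : Ω → Z} (hφ : Measurable[m] φ) {C : Set (Z × X)}
    (hC : MeasurableSet C) :
    μ⟦{ω | (φ ω, Y ω) ∈ C} | m⟧ =ᵐ[μ] fun ω => (Q ω).real {x | (φ ω, x) ∈ C} := by
  have hQ := h.1
  have hφ' : Measurable φ := hφ.mono hm le_rfl
  have hpair : Measurable fun ω => (φ ω, Y ω) := hφ'.prodMk hY
  have hsec : ∀ {C : Set (Z × X)}, MeasurableSet C → ∀ z, MeasurableSet {x | (z, x) ∈ C} :=
    fun hC z => measurable_prodMk_left hC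
  have hind : ∀ {C : Set (Z × X)}, MeasurableSet C →
      Integrable ({ω | (φ ω, Y ω) ∈ C}.indicator fun _ => (1 : ℝ)) μ :=
    fun hC => (integrable_const (1 : ℝ)).indicator (hpair hC)
  induction C, hC using MeasurableSpace.induction_on_inter generateFrom_prod.symm
    isPiSystem_prod with
  | empty => simp
  | basic t ht =>
    obtain ⟨U, hU, V, hV, rfl⟩ := ht
    have e : ({ω | (φ ω, Y ω) ∈ U ×ˢ V}.indicator fun _ => (1 : ℝ)) =
        (φ ⁻¹' U).indicator ((Y ⁻¹' V).indicator fun _ => (1 : ℝ)) := by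
      ext ω
      by_cases h1 : φ ω ∈ U <;> by_cases h2 : Y ω ∈ V <;> simp [h1, h2]
    rw [e]
    refine (condExp_indicator ((integrable_const (1 : ℝ)).indicator (hY hV)) (hφ hU)).trans ?_
    filter_upwards [h.2 V hV] with ω hω
    by_cases h1 : φ ω ∈ U
    · simp [h1, hω]
    · simp [h1]
  | compl t ht ih =>
    have e : ({ω | (φ ω, Y ω) ∈ tᶜ}.indicator fun _ => (1 : ℝ)) =
        (fun _ => (1 : ℝ)) - {ω | (φ ω, Y ω) ∈ t}.indicator fun _ => (1 : ℝ) := by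
      ext ω
      by_cases h1 : (φ ω, Y ω) ∈ t <;> simp [h1]
    rw [e]
    refine (condExp_sub (integrable_const 1) (hind ht) m).trans ?_
    filter_upwards [ih] with ω hω
    have hc : {x | (φ ω, x) ∈ tᶜ} = {x | (φ ω, x) ∈ t}ᶜ := rfl
    rw [Pi.sub_apply, condExp_const hm, hω, hc, probReal_compl_eq_one_sub (hsec ht _)]
  | iUnion f hf hfm ih =>
    have hdisj : ∀ ω, Pairwise (Function.onFun Disjoint fun i => {x | (φ ω, x) ∈ f i}) :=
      fun ω i j hij => Set.disjoint_left.2 fun x hi hj => Set.disjoint_left.1 (hf hij) hi hj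
    have hsum : ∀ ω, HasSum (fun i => (Q ω).real {x | (φ ω, x) ∈ f i})
        ((Q ω).real {x | (φ ω, x) ∈ ⋃ i, f i}) := by
      intro ω
      have e : {x | (φ ω, x) ∈ ⋃ i, f i} = ⋃ i, {x | (φ ω, x) ∈ f i} := by
        ext x; simp
      have h1 := measure_iUnion (μ := Q ω) (hdisj ω) fun i => hsec (hfm i) _
      rw [e, measureReal_def, h1]
      have h2 : ∑' i, Q ω {x | (φ ω, x) ∈ f i} ≠ ∞ := h1 ▸ measure_ne_top (Q ω) _
      rw [ENNReal.tsum_toReal_eq (fun i => measure_ne_top _ _)]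
      exact ENNReal.hasSum_toReal h2
    set gs : ℕ → Ω → ℝ := fun n ω => ∑ i ∈ Finset.range n, (Q ω).real {x | (φ ω, x) ∈ f i}
    set fs : ℕ → Ω → ℝ := fun n => ∑ i ∈ Finset.range n,
      {ω | (φ ω, Y ω) ∈ f i}.indicator fun _ => (1 : ℝ)
    have hfsi : ∀ n, Integrable (fs n) μ := fun n =>
      integrable_finsetSum' _ fun i _ => hind (hfm i)
    have hfg : ∀ n, μ[fs n|m] =ᵐ[μ] gs n := by
      intro n
      refine (condExp_finsetSum (fun i _ => hind (hfm i)) m).trans ?_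
      filter_upwards [ae_all_iff.2 ih] with ω hω
      simp [gs, hω]
    -- `Q` is not assumed measurable in `ω`. Measurability up to null sets is inherited from the
    -- conditional expectations of the partial sums, and for the limit from their `limsup`.
    have hgsm : ∀ n, AEStronglyMeasurable[m] (gs n) μ := fun n =>
      ⟨μ[fs n|m], stronglyMeasurable_condExp, (hfg n).symm⟩
    have hgsi : ∀ n, Integrable (gs n) μ := fun n => integrable_condExp.congr (hfg n)
    have hgs_lim : ∀ ω, Filter.Tendsto (fun n => gs n ω) Filter.atTop
        (nhds ((Q ω).real {x | (φ ω, x) ∈ ⋃ i, f i})) := fun ω => (hsum ω).tendsto_sum_nat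
    have hgs_bd : ∀ n ω, ‖gs n ω‖ ≤ 1 := by
      intro n ω
      rw [Real.norm_eq_abs, abs_of_nonneg (Finset.sum_nonneg fun i _ => measureReal_nonneg)]
      exact (sum_le_hasSum _ (fun i _ => measureReal_nonneg) (hsum ω)).trans measureReal_le_one
    have hlimm : AEStronglyMeasurable[m]
        (fun ω => (Q ω).real {x | (φ ω, x) ∈ ⋃ i, f i}) μ := by
      refine ⟨fun ω => Filter.limsup (fun n => (μ[fs n|m]) ω) Filter.atTop,
        (Measurable.limsup fun n => stronglyMeasurable_condExp.measurable).stronglyMeasurable, ?_⟩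
      filter_upwards [ae_all_iff.2 hfg] with ω hω
      simp_rw [hω]
      exact (hgs_lim ω).limsup_eq.symm
    have hfs_sum : ∀ ω, HasSum (fun i => {ω | (φ ω, Y ω) ∈ f i}.indicator (fun _ => (1 : ℝ)) ω)
        ({ω | (φ ω, Y ω) ∈ ⋃ i, f i}.indicator (fun _ => (1 : ℝ)) ω) := by
      intro ω
      by_cases hω : ∃ i, (φ ω, Y ω) ∈ f i
      · obtain ⟨i, hi⟩ := hω
        have hi : ω ∈ {ω | (φ ω, Y ω) ∈ f i} := hi
        have e1 : {ω | (φ ω, Y ω) ∈ ⋃ i, f i}.indicator (fun _ => (1 : ℝ)) ω =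
            {ω | (φ ω, Y ω) ∈ f i}.indicator (fun _ => (1 : ℝ)) ω := by
          rw [Set.indicator_of_mem hi,
            Set.indicator_of_mem (s := {ω | (φ ω, Y ω) ∈ ⋃ i, f i}) (Set.mem_iUnion.2 ⟨i, hi⟩)]
        rw [e1]
        refine hasSum_single i fun j hj => Set.indicator_of_notMem (fun hj' => ?_) _
        exact Set.disjoint_left.1 (hf hj) hj' hi
      · push Not at hω
        have e1 : {ω | (φ ω, Y ω) ∈ ⋃ i, f i}.indicator (fun _ => (1 : ℝ)) ω = 0 :=
          Set.indicator_of_notMem (fun h => by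
            obtain ⟨i, hi⟩ := Set.mem_iUnion.1 h; exact hω i hi) _
        rw [e1]
        convert hasSum_zero using 2 with i
        exact Set.indicator_of_notMem (s := {ω | (φ ω, Y ω) ∈ f i}) (hω i) _
    have hfs_bd : ∀ n ω, ‖fs n ω‖ ≤ 1 := by
      intro n ω
      simp only [fs, Finset.sum_apply]
      rw [Real.norm_eq_abs, abs_of_nonneg (Finset.sum_nonneg fun i _ =>
        Set.indicator_nonneg (fun _ _ => zero_le_one) _)]
      refine (sum_le_hasSum _ (fun i _ => Set.indicator_nonneg (fun _ _ => zero_le_one) _)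
        (hfs_sum ω)).trans (Set.indicator_le_self' (fun _ _ => zero_le_one) _)
    have hfs_lim : ∀ ω, Filter.Tendsto (fun n => fs n ω) Filter.atTop
        (nhds ({ω | (φ ω, Y ω) ∈ ⋃ i, f i}.indicator (fun _ => (1 : ℝ)) ω)) := fun ω => by
      simpa [fs] using (hfs_sum ω).tendsto_sum_nat
    -- Dominated convergence for conditional expectations; both sequences of partial sums are
    -- bounded by `1`.
    refine (tendsto_condExp_unique fs gs _
      (fun ω => (Q ω).real {x | (φ ω, x) ∈ ⋃ i, f i}) hfsi hgsi (.of_forall hfs_lim)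
      (.of_forall hgs_lim) (fun _ => 1) (integrable_const 1) (fun _ => 1) (integrable_const 1)
      (fun n => .of_forall (hfs_bd n)) (fun n => .of_forall (hgs_bd n)) fun n =>
        (hfg n).trans (condExp_of_aestronglyMeasurable' hm (hgsm n) (hgsi n)).symm).trans ?_
    refine condExp_of_aestronglyMeasurable' hm hlimm ?_
    refine Integrable.of_bound (hlimm.mono hm) 1 (.of_forall fun ω => ?_)
    rw [Real.norm_eq_abs, abs_of_nonneg measureReal_nonneg]; exact measureReal_le_one

end CondLaw

/-! ### Returns of a policy -/

section Chain

variable {S A Θ : Type*} [MeasurableSpace S] [MeasurableSpace A] [MeasurableSpace Θ] {d : ℕ}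
  {P : Set (EuclideanSpace ℝ (Fin d))} (M : PMDP S A P) (pol : Kernel (Θ × S) A)

/-- Markov operator of the controlled chain. -/
def stepOp (f : ChainState Θ P S A → ℝ) (x : ChainState Θ P S A) : ℝ :=
  ∫ y, f y ∂(stepKernel M pol x)

theorem measurable_stepOp {f : ChainState Θ P S A → ℝ} (hf : Measurable f) :
    Measurable (stepOp M pol f) :=
  (StronglyMeasurable.integral_kernel hf.stronglyMeasurable).measurable

variable [IsMarkovKernel pol]

instance : IsMarkovKernel (chainKernel M pol) := by
  unfold chainKernel
  infer_instance

theorem chainKernel_map_zero : (chainKernel M pol).map (fun z => z 0) = Kernel.id := by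
  have h := Kernel.traj_map_frestrictLe (X := fun _ => ChainState Θ P S A)
    (κ := fun n => (stepKernel M pol).comap
      (fun h : (i : Finset.Iic n) → ChainState Θ P S A => h ⟨n, by simp⟩)
      (measurable_pi_apply _)) 0 0
  have e : (fun z : ℕ → ChainState Θ P S A => z 0) =
      (fun h : (i : Finset.Iic (0 : ℕ)) → ChainState Θ P S A => h ⟨0, by simp⟩) ∘
        Preorder.frestrictLe (π := fun _ => ChainState Θ P S A) 0 := rfl
  rw [chainKernel, ← Kernel.comap_map_comm _ _ (measurable_pi_apply 0), e,
    Kernel.map_comp_right _ (Preorder.measurable_frestrictLe 0) (measurable_pi_apply _), h,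
    Kernel.partialTraj_self]
  ext x B hB
  have hm : Measurable fun h : (i : Finset.Iic (0 : ℕ)) → ChainState Θ P S A => h ⟨0, by simp⟩ :=
    measurable_pi_apply _
  rw [Kernel.comap_apply, Kernel.map_apply _ hm, Kernel.id_apply, Kernel.id_apply]
  exact congrArg (fun ν : Measure (ChainState Θ P S A) => ν B) (Measure.map_dirac' hm fun _ => x)

/-- The Markov property at the level of marginals: the transition of the trajectory measure reads
only the last coordinate of the history. -/
theorem chainKernel_map_succ (t : ℕ) : (chainKernel M pol).map (fun z => z (t + 1)) =
    stepKernel M pol ∘ₖ (chainKernel M pol).map (fun z => z t) := by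
  set κ : (n : ℕ) → Kernel ((i : Finset.Iic n) → ChainState Θ P S A) (ChainState Θ P S A) :=
    fun n => (stepKernel M pol).comap
      (fun h : (i : Finset.Iic n) → ChainState Θ P S A => h ⟨n, by simp⟩)
      (measurable_pi_apply _) with hκ
  have key : (Kernel.traj (X := fun _ => ChainState Θ P S A) κ 0).map (fun z => z (t + 1)) =
      stepKernel M pol ∘ₖ
        (Kernel.traj (X := fun _ => ChainState Θ P S A) κ 0).map (fun z => z t) := by
    have e : (fun z : ℕ → ChainState Θ P S A => z t) =
        (fun h : (i : Finset.Iic t) → ChainState Θ P S A => h ⟨t, by simp⟩) ∘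
          Preorder.frestrictLe (π := fun _ => ChainState Θ P S A) t := rfl
    have hm : Measurable fun h : (i : Finset.Iic t) → ChainState Θ P S A => h ⟨t, by simp⟩ :=
      measurable_pi_apply _
    rw [← Kernel.traj_comp_partialTraj (X := fun _ => ChainState Θ P S A) (κ := κ)
      (Nat.zero_le t), Kernel.map_comp, Kernel.map_traj_succ_self,
      Kernel.traj_comp_partialTraj (Nat.zero_le t), e,
      Kernel.map_comp_right _ (Preorder.measurable_frestrictLe t) hm,
      Kernel.traj_map_frestrictLe, Kernel.comp_map _ _ hm]
  rw [chainKernel, ← Kernel.comap_map_comm _ _ (measurable_pi_apply _), key,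
    ← Kernel.comap_map_comm _ _ (measurable_pi_apply _)]
  rfl

variable {M pol}

theorem abs_stepOp_le {f : ChainState Θ P S A → ℝ} {K : ℝ} (hK : ∀ x, |f x| ≤ K)
    (x : ChainState Θ P S A) : |stepOp M pol f x| ≤ K :=
  abs_integral_le_of_abs_le _ hK

/-- Reduces expected rewards at time `t` to iterates of a one-step operator, where regularity in the
parameter can be followed step by step. -/
theorem integral_chainKernel {f : ChainState Θ P S A → ℝ} (hf : Measurable f) {K : ℝ}
    (hK : ∀ x, |f x| ≤ K) (t : ℕ) (x : ChainState Θ P S A) :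
    ∫ z, f (z t) ∂(chainKernel M pol x) = (stepOp M pol)^[t] f x := by
  have hmap : ∀ t (f : ChainState Θ P S A → ℝ), Measurable f →
      ∫ z, f (z t) ∂(chainKernel M pol x) =
        ∫ y, f y ∂((chainKernel M pol).map (fun z => z t) x) := by
    intro t f hf
    rw [Kernel.map_apply _ (measurable_pi_apply t),
      integral_map (measurable_pi_apply t).aemeasurable hf.aestronglyMeasurable]
  induction t generalizing f with
  | zero =>
    rw [hmap 0 f hf, chainKernel_map_zero, Kernel.id_apply,
      integral_dirac' _ _ hf.stronglyMeasurable]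
    rfl
  | succ t ih =>
    have := Kernel.IsMarkovKernel.map (chainKernel M pol)
      (measurable_pi_apply (X := fun _ : ℕ => ChainState Θ P S A) t)
    have hi : Integrable f ((stepKernel M pol ∘ₖ (chainKernel M pol).map (fun z => z t)) x) :=
      Integrable.of_bound hf.aestronglyMeasurable K (.of_forall hK)
    rw [hmap _ f hf, chainKernel_map_succ, Kernel.integral_comp hi, Function.iterate_succ_apply,
      ← ih (measurable_stepOp M pol hf) (abs_stepOp_le hK), hmap _ _ (measurable_stepOp M pol hf)]
    rfl

/-- The law of `s', r, a'` given the current state of the chain. -/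
theorem integral_stepKernel {f : ChainState Θ P S A → ℝ} (hf : Measurable f) {K : ℝ}
    (hK : ∀ x, |f x| ≤ K) (x : ChainState Θ P S A) :
    stepOp M pol f x = ∫ s', ∫ w, f (x.1, (w.1, s', w.2))
      ∂((M.R (x.2.2.1, x.2.2.2, s', x.1.2)).prod (pol (x.1.1, s')))
        ∂(M.T (x.2.2.1, x.2.2.2, x.1.2)) := by
  have hm : Measurable fun w : S × ℝ × A => (w.2.1, w.1, w.2.2) := by fun_prop
  have : IsMarkovKernel
    (((M.T.comap (fun x : ChainState Θ P S A => (x.2.2.1, x.2.2.2, x.1.2)) (by fun_prop)) ⊗ₖ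
        ((M.R.comap (fun y : ChainState Θ P S A × S =>
            (y.1.2.2.1, y.1.2.2.2, y.2, y.1.1.2)) (by fun_prop)) ×ₖ
          (pol.comap (fun y : ChainState Θ P S A × S => (y.1.1.1, y.2)) (by fun_prop)))).map
      (fun w : S × ℝ × A => (w.2.1, w.1, w.2.2))) := Kernel.IsMarkovKernel.map _ hm
  have hfx : Measurable fun y => f (x.1, y) := hf.comp measurable_prodMk_left
  rw [stepOp, stepKernel, Kernel.prod_apply, Kernel.deterministic_apply, Measure.dirac_prod,
    integral_map measurable_prodMk_left.aemeasurable hf.aestronglyMeasurable,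
    Kernel.map_apply _ hm, integral_map hm.aemeasurable hfx.aestronglyMeasurable,
    integral_compProd]
  · refine integral_congr_ae (.of_forall fun s' => ?_)
    dsimp only
    rw [Kernel.prod_apply]
    rfl
  · exact Integrable.of_bound (hfx.comp hm).aestronglyMeasurable K
      (.of_forall fun _ => hK _)

theorem ae_stepKernel_abs_reward_le {R₀ : ℝ} (hR : BoundedReward M R₀)
    (x : ChainState Θ P S A) : ∀ᵐ y ∂(stepKernel M pol x), |y.2.1| ≤ R₀ := by
  have hm : Measurable fun w : S × ℝ × A => (w.2.1, w.1, w.2.2) := by fun_prop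
  have hset : MeasurableSet {y : ChainState Θ P S A | |y.2.1| ≤ R₀} :=
    measurableSet_le (measurable_norm.comp (by fun_prop : Measurable
      fun y : ChainState Θ P S A => y.2.1)) measurable_const
  have hset1 : MeasurableSet {y : ℝ × S × A | |((x.1, y) : ChainState Θ P S A).2.1| ≤ R₀} :=
    measurable_prodMk_left hset
  have hset2 : MeasurableSet {w : ℝ × A | |w.1| ≤ R₀} :=
    measurableSet_le (measurable_norm.comp measurable_fst) measurable_const
  have : IsMarkovKernel
    (((M.T.comap (fun x : ChainState Θ P S A => (x.2.2.1, x.2.2.2, x.1.2)) (by fun_prop)) ⊗ₖ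
        ((M.R.comap (fun y : ChainState Θ P S A × S =>
            (y.1.2.2.1, y.1.2.2.2, y.2, y.1.1.2)) (by fun_prop)) ×ₖ
          (pol.comap (fun y : ChainState Θ P S A × S => (y.1.1.1, y.2)) (by fun_prop)))).map
      (fun w : S × ℝ × A => (w.2.1, w.1, w.2.2))) := Kernel.IsMarkovKernel.map _ hm
  rw [stepKernel, Kernel.prod_apply, Kernel.deterministic_apply, Measure.dirac_prod,
    ae_map_iff measurable_prodMk_left.aemeasurable hset, Kernel.map_apply _ hm,
    ae_map_iff hm.aemeasurable hset1, Kernel.ae_compProd_iff]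
  · refine .of_forall fun s' => ?_
    rw [Kernel.prod_apply]
    have h1 := hR (x.2.2.1, x.2.2.2, s', x.1.2)
    refine (Measure.ae_prod_iff_ae_ae hset2).2 ?_
    filter_upwards [h1] with r hr
    exact .of_forall fun _ => hr
  · exact hm hset1

theorem ae_chainKernel_abs_reward_le {R₀ : ℝ} (hR : BoundedReward M R₀)
    (x : ChainState Θ P S A) : ∀ᵐ z ∂(chainKernel M pol x), ∀ t : ℕ, |(z (t + 1)).2.1| ≤ R₀ := by
  rw [ae_all_iff]
  intro t
  have hset : MeasurableSet {y : ChainState Θ P S A | |y.2.1| ≤ R₀} :=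
    measurableSet_le (measurable_norm.comp (by fun_prop : Measurable
      fun y : ChainState Θ P S A => y.2.1)) measurable_const
  refine ae_of_ae_map (f := fun z : ℕ → ChainState Θ P S A => z (t + 1))
    (p := fun y => |y.2.1| ≤ R₀) (measurable_pi_apply _).aemeasurable ?_
  rw [← Kernel.map_apply _ (measurable_pi_apply _), chainKernel_map_succ,
    Kernel.ae_comp_iff hset]
  exact .of_forall fun y => ae_stepKernel_abs_reward_le hR y

/-- The law of `0, s₀, a₀` as a function of the policy parameter. -/
theorem integral_startKernel_congr {f g : ℝ × S × A → ℝ} (hf : Measurable f) (hg : Measurable g)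
    {δ K : ℝ} (hfK : ∀ y, |f y| ≤ K) (hgK : ∀ y, |g y| ≤ K) (h : ∀ y, |f y - g y| ≤ δ)
    (θ : Θ) (p p' : P) :
    |∫ x, f x.2 ∂(startKernel M pol (θ, p)) - ∫ x, g x.2 ∂(startKernel M pol (θ, p'))| ≤ δ := by
  have hm : Measurable fun sa : S × A => ((0 : ℝ), sa.1, sa.2) := by fun_prop
  set ν := ((Kernel.const (Θ × P) M.init) ⊗ₖ
        (pol.comap (fun y : (Θ × P) × S => (y.1.1, y.2)) (by fun_prop))).map
      (fun sa : S × A => ((0 : ℝ), sa.1, sa.2)) with hν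
  have : IsMarkovKernel ν := Kernel.IsMarkovKernel.map _ hm
  -- Neither the initial distribution nor the policy depends on the environment parameter.
  have hνp : ν (θ, p) = ν (θ, p') := by
    ext B hB
    rw [hν, Kernel.map_apply' _ hm _ hB, Kernel.map_apply' _ hm _ hB,
      Kernel.compProd_apply (hm hB), Kernel.compProd_apply (hm hB)]
    rfl
  have hint : ∀ (q : P) (f : ℝ × S × A → ℝ), Measurable f →
      ∫ x, f x.2 ∂(startKernel M pol (θ, q)) = ∫ y, f y ∂(ν (θ, q)) := by
    intro q f hf
    have hf2 : Measurable fun x : ChainState Θ P S A => f x.2 := hf.comp measurable_snd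
    rw [startKernel, Kernel.prod_apply, Kernel.id_apply, Measure.dirac_prod,
      integral_map measurable_prodMk_left.aemeasurable hf2.aestronglyMeasurable]
  rw [hint p f hf, hint p' g hg, hνp, ← integral_sub
    (Integrable.of_bound hf.aestronglyMeasurable K (.of_forall hfK))
    (Integrable.of_bound hg.aestronglyMeasurable K (.of_forall hgK))]
  exact abs_integral_le_of_abs_le _ h

end Chain

/-! ### Truncated returns. -/

/-- Truncation of a reward to `[-R, R]`. -/
def clip (R r : ℝ) : ℝ := max (-R) (min r R)

theorem abs_clip_le {R : ℝ} (hR : 0 ≤ R) (r : ℝ) : |clip R r| ≤ R :=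
  abs_le.2 ⟨le_max_left _ _, max_le (by linarith) (min_le_right _ _)⟩

theorem clip_eq {R r : ℝ} (h : |r| ≤ R) : clip R r = r := by
  rw [clip, min_eq_left (abs_le.1 h).2, max_eq_right (abs_le.1 h).1]

theorem measurable_clip (R : ℝ) : Measurable (clip R) :=
  measurable_const.max (measurable_id.min measurable_const)

/-- Discounted sum of the truncated rewards. -/
def boundedReturn {S A : Type*} (γ R : ℝ) (z : Trajectory S A) : ℝ :=
  ∑' t : ℕ, γ ^ t * clip R (z (t + 1)).1

section Return

variable {S A : Type*} {γ R : ℝ}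

theorem norm_discounted_clip_le (hγ0 : 0 ≤ γ) (hR : 0 ≤ R) (t : ℕ) (r : ℝ) :
    ‖γ ^ t * clip R r‖ ≤ γ ^ t * R := by
  rw [norm_mul, norm_pow, Real.norm_eq_abs γ, abs_of_nonneg hγ0]
  exact mul_le_mul_of_nonneg_left (abs_clip_le hR r) (pow_nonneg hγ0 t)

theorem hasSum_discount (hγ0 : 0 ≤ γ) (hγ1 : γ < 1) (R : ℝ) :
    HasSum (fun t : ℕ => γ ^ t * R) (R / (1 - γ)) := by
  rw [div_eq_inv_mul]
  exact (hasSum_geometric_of_lt_one hγ0 hγ1).mul_right R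

theorem hasSum_boundedReturn (hγ0 : 0 ≤ γ) (hγ1 : γ < 1) (hR : 0 ≤ R) (z : Trajectory S A) :
    HasSum (fun t : ℕ => γ ^ t * clip R (z (t + 1)).1) (boundedReturn γ R z) :=
  (Summable.of_norm_bounded (hasSum_discount hγ0 hγ1 R).summable
    fun t => norm_discounted_clip_le hγ0 hR t _).hasSum

theorem abs_boundedReturn_le (hγ0 : 0 ≤ γ) (hγ1 : γ < 1) (hR : 0 ≤ R) (z : Trajectory S A) :
    |boundedReturn γ R z| ≤ R / (1 - γ) :=
  tsum_of_norm_bounded (hasSum_discount hγ0 hγ1 R) fun t => norm_discounted_clip_le hγ0 hR t _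

/-- Truncation makes summability, bounds and measurability hold for every trajectory; it is inactive
on almost every trajectory of the model. -/
theorem boundedReturn_eq {z : Trajectory S A} (h : ∀ t : ℕ, |(z (t + 1)).1| ≤ R) :
    boundedReturn γ R z = discountedReward γ z :=
  tsum_congr fun t => by rw [clip_eq (h t)]

variable [MeasurableSpace S] [MeasurableSpace A]

theorem measurable_boundedReturn (hγ0 : 0 ≤ γ) (hγ1 : γ < 1) (hR : 0 ≤ R) :
    Measurable (boundedReturn γ R : Trajectory S A → ℝ) := by
  refine measurable_of_tendsto_metrizable (f := fun n (z : Trajectory S A) =>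
    ∑ t ∈ Finset.range n, γ ^ t * clip R (z (t + 1)).1) (fun n => ?_) ?_
  · refine Finset.measurable_fun_sum _ fun t _ => ?_
    exact ((measurable_clip R).comp (by fun_prop :
      Measurable fun z : Trajectory S A => (z (t + 1)).1)).const_mul _
  · rw [tendsto_pi_nhds]
    exact fun z => (hasSum_boundedReturn hγ0 hγ1 hR z).tendsto_sum_nat

theorem measurableSet_bounded_rewards (R : ℝ) :
    MeasurableSet {z : Trajectory S A | ∀ t : ℕ, |(z (t + 1)).1| ≤ R} := by
  rw [Set.ofPred_forall]
  refine MeasurableSet.iInter fun t => measurableSet_le ?_ measurable_const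
  exact measurable_norm.comp (by fun_prop : Measurable fun z : Trajectory S A => (z (t + 1)).1)

end Return

/-! ### Lipschitz dependence of the expected return on the environment parameter. -/

section Lipschitz

variable {S A Θ : Type*} [MeasurableSpace S] [MeasurableSpace A] [MeasurableSpace Θ] {d : ℕ}
  {P : Set (EuclideanSpace ℝ (Fin d))} {M : PMDP S A P} {pol : Kernel (Θ × S) A}
  [IsMarkovKernel pol]

/-- Measurable functions of the state of the chain that are bounded by `K`, do not depend on the
last reward, and are `L`-Lipschitz in the environment parameter. -/
structure LipObservable (f : ChainState Θ P S A → ℝ) (K L : ℝ) : Prop where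
  measurable : Measurable f
  bound : ∀ x, |f x| ≤ K
  lip : ∀ (θ : Θ) (p p' : P) (r r' : ℝ) (s : S) (a : A),
    |f ((θ, p), (r, s, a)) - f ((θ, p'), (r', s, a))| ≤ L * dist p p'

/-- The parameter is changed first in the inner integral, at cost `L`, and then in the transition
law, at cost `2 * K * LT` by total variation. The current reward drops out because the step law
ignores it. -/
theorem lipObservable_stepOp_of {f : ChainState Θ P S A → ℝ} {K L LT : ℝ} (hf : Measurable f)
    (hK : ∀ x, |f x| ≤ K) (hT : TransitionLipschitz M LT)
    (hA : ∀ (θ : Θ) (p p' : P) (s : S) (a : A) (s' : S),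
      |∫ w, f ((θ, p), (w.1, s', w.2)) ∂((M.R (s, a, s', p)).prod (pol (θ, s'))) -
        ∫ w, f ((θ, p'), (w.1, s', w.2)) ∂((M.R (s, a, s', p')).prod (pol (θ, s')))|
        ≤ L * dist p p') :
    LipObservable (stepOp M pol f) K (L + 2 * K * LT) := by
  refine ⟨measurable_stepOp _ _ hf, abs_stepOp_le hK, fun θ p p' r r' s a => ?_⟩
  have hK0 : 0 ≤ K := (abs_nonneg _).trans (hK ((θ, p), (r, s, a)))
  set G : P → S → ℝ := fun p s' =>
    ∫ w, f ((θ, p), (w.1, s', w.2)) ∂((M.R (s, a, s', p)).prod (pol (θ, s'))) with hG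
  have hGm : ∀ p, Measurable (G p) := by
    intro p
    have hR : Measurable fun s' : S => (s, a, s', p) := by fun_prop
    have hp : Measurable fun s' : S => (θ, s') := by fun_prop
    have hm : Measurable fun y : S × ℝ × A =>
        f ((θ, p), (y.2.1, y.1, y.2.2)) := hf.comp (by fun_prop)
    have := (hm.stronglyMeasurable.integral_kernel_prod_right'
      (κ := (M.R.comap _ hR) ×ₖ (pol.comap _ hp))).measurable
    convert this using 2 with s'
    rw [Kernel.prod_apply]
    rfl
  have hGb : ∀ p s', |G p s'| ≤ K := fun p s' =>
    abs_integral_le_of_abs_le _ fun _ => hK _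
  have hGi : ∀ p q, Integrable (G p) (M.T (s, a, q)) := fun p q =>
    Integrable.of_bound (hGm p).aestronglyMeasurable K (.of_forall (hGb p))
  rw [integral_stepKernel hf hK, integral_stepKernel hf hK]
  change |∫ s', G p s' ∂(M.T (s, a, p)) - ∫ s', G p' s' ∂(M.T (s, a, p'))| ≤ _
  have h1 : |∫ s', G p s' ∂(M.T (s, a, p)) - ∫ s', G p' s' ∂(M.T (s, a, p))| ≤ L * dist p p' := by
    rw [← integral_sub (hGi _ _) (hGi _ _)]
    exact abs_integral_le_of_abs_le _ fun s' => hA θ p p' s a s'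
  have h2 : |∫ s', G p' s' ∂(M.T (s, a, p)) - ∫ s', G p' s' ∂(M.T (s, a, p'))| ≤
      2 * K * (LT * dist p p') :=
    (abs_integral_sub_le_tv _ _ (hGm p') (hGb p')).trans
      (mul_le_mul_of_nonneg_left (hT s a p p') (by linarith))
  calc _ ≤ L * dist p p' + 2 * K * (LT * dist p p') := by
        refine (abs_sub_le _ (∫ s', G p' s' ∂(M.T (s, a, p))) _).trans (add_le_add h1 h2)
    _ = _ := by ring

theorem LipObservable.stepOp {f : ChainState Θ P S A → ℝ} {K L LT : ℝ} (hf : LipObservable f K L)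
    (hT : TransitionLipschitz M LT) :
    LipObservable (stepOp M pol f) K (L + 2 * K * LT) := by
  refine lipObservable_stepOp_of hf.measurable hf.bound hT fun θ p p' s a s' => ?_
  -- The case `p = p'` of `lip` says that `f` ignores the reward, so the reward law integrates out
  -- and only the policy, which is free of `p`, remains.
  have hr : ∀ (q : P) (w : ℝ × A), f ((θ, q), (w.1, s', w.2)) = f ((θ, q), (0, s', w.2)) := by
    intro q w
    have := hf.lip θ q q w.1 0 s' w.2
    rw [dist_self, mul_zero] at this
    exact sub_eq_zero.1 (abs_nonpos_iff.1 this)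
  have hm : ∀ q, Measurable fun b : A => f ((θ, q), (0, s', b)) := fun q =>
    hf.measurable.comp (by fun_prop)
  have hint : ∀ q : P, ∫ w, f ((θ, q), (w.1, s', w.2)) ∂((M.R (s, a, s', q)).prod (pol (θ, s'))) =
      ∫ b, f ((θ, q), (0, s', b)) ∂(pol (θ, s')) := by
    intro q
    simp_rw [hr]
    rw [integral_fun_snd (fun b => f ((θ, q), (0, s', b)))]
    simp
  have hi : ∀ q, Integrable (fun b => f ((θ, q), (0, s', b))) (pol (θ, s')) := fun q =>
    Integrable.of_bound (hm q).aestronglyMeasurable K (.of_forall fun _ => hf.bound _)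
  rw [hint, hint, ← integral_sub (hi p) (hi p')]
  exact abs_integral_le_of_abs_le _ fun b => hf.lip θ p p' 0 0 s' b

/-- Only the mean reward is Lipschitz, not its law. This suffices because the truncated reward is
almost surely the reward itself, so its integral is that mean. -/
theorem lipObservable_stepOp_reward {R LR LT : ℝ} (hR0 : 0 ≤ R) (hR : BoundedReward M R)
    (hT : TransitionLipschitz M LT) (hLR : RewardLipschitz M LR) :
    LipObservable (stepOp M pol fun x => clip R x.2.1) R (LR + 2 * R * LT) := by
  have hm : Measurable fun x : ChainState Θ P S A => clip R x.2.1 :=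
    (measurable_clip R).comp (by fun_prop)
  refine lipObservable_stepOp_of hm (fun x => abs_clip_le hR0 _) hT fun θ p p' s a s' => ?_
  have hint : ∀ q : P, ∫ w, clip R w.1 ∂((M.R (s, a, s', q)).prod (pol (θ, s'))) =
      ∫ r, r ∂(M.R (s, a, s', q)) := by
    intro q
    rw [integral_fun_fst (fun r => clip R r)]
    simp only [probReal_univ, one_smul]
    refine integral_congr_ae ?_
    filter_upwards [hR (s, a, s', q)] with r hr using clip_eq hr
  dsimp only
  rw [hint, hint]
  exact hLR s a s' p p'

/-- The uniform bound `R` is preserved, so every step adds the same `2 * R * LT`; growth is linear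
rather than geometric, hence summable for every `γ < 1`. -/
theorem lipObservable_iterate {R LR LT : ℝ} (hR0 : 0 ≤ R) (hR : BoundedReward M R)
    (hT : TransitionLipschitz M LT) (hLR : RewardLipschitz M LR) (t : ℕ) :
    LipObservable ((stepOp M pol)^[t + 1] fun x => clip R x.2.1) R
      (LR + (t + 1) * (2 * R * LT)) := by
  induction t with
  | zero => simpa using lipObservable_stepOp_reward hR0 hR hT hLR
  | succ t ih =>
    rw [Function.iterate_succ_apply']
    have := ih.stepOp (pol := pol) hT
    convert this using 1
    push_cast
    ring

theorem ae_trajKernel_abs_reward_le {R : ℝ} (hR : BoundedReward M R) (x : Θ × P) :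
    ∀ᵐ z ∂(trajKernel M pol x), ∀ t : ℕ, |(z (t + 1)).1| ≤ R := by
  have hm : Measurable fun (z : ℕ → ChainState Θ P S A) t => (z t).2 := by fun_prop
  have hset : MeasurableSet {z : ℕ → ChainState Θ P S A | ∀ t : ℕ, |(z (t + 1)).2.1| ≤ R} :=
    hm (measurableSet_bounded_rewards R)
  rw [trajKernel, Kernel.map_apply _ hm, ae_map_iff hm.aemeasurable
    (measurableSet_bounded_rewards R), Kernel.ae_comp_iff hset]
  exact .of_forall fun y => ae_chainKernel_abs_reward_le hR y

variable {γ R : ℝ}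

theorem J_eq_integral_boundedReturn (hR : BoundedReward M R) (θ : Θ) (p : P) :
    J M pol γ θ p = ∫ z, boundedReturn γ R z ∂(trajKernel M pol (θ, p)) := by
  refine integral_congr_ae ?_
  filter_upwards [ae_trajKernel_abs_reward_le hR (θ, p)] with z hz
  exact (boundedReturn_eq hz).symm

theorem abs_J_le (hγ0 : 0 ≤ γ) (hγ1 : γ < 1) (hR0 : 0 ≤ R) (hR : BoundedReward M R) (θ : Θ)
    (p : P) : |J M pol γ θ p| ≤ R / (1 - γ) := by
  rw [J_eq_integral_boundedReturn hR]
  exact abs_integral_le_of_abs_le _ fun z => abs_boundedReturn_le hγ0 hγ1 hR0 z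

theorem measurable_J (hγ0 : 0 ≤ γ) (hγ1 : γ < 1) (hR0 : 0 ≤ R) (hR : BoundedReward M R) :
    Measurable fun x : Θ × P => J M pol γ x.1 x.2 := by
  simp_rw [J_eq_integral_boundedReturn hR]
  exact (StronglyMeasurable.integral_kernel
    (measurable_boundedReturn hγ0 hγ1 hR0).stronglyMeasurable).measurable

theorem hasSum_J (hγ0 : 0 ≤ γ) (hγ1 : γ < 1) (hR0 : 0 ≤ R) (hR : BoundedReward M R) (θ : Θ)
    (p : P) :
    HasSum (fun t : ℕ => γ ^ t * ∫ x, (stepOp M pol)^[t + 1] (fun x => clip R x.2.1) x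
      ∂(startKernel M pol (θ, p))) (J M pol γ θ p) := by
  have hcm : Measurable fun x : ChainState Θ P S A => clip R x.2.1 :=
    (measurable_clip R).comp (by fun_prop)
  have hm : Measurable fun (z : ℕ → ChainState Θ P S A) t => (z t).2 := by fun_prop
  have h := hasSum_integral_of_dominated_convergence (μ := trajKernel M pol (θ, p))
    (F := fun (t : ℕ) (z : Trajectory S A) => γ ^ t * clip R (z (t + 1)).1)
    (f := boundedReturn γ R) (fun t _ => γ ^ t * R)
    (fun t => (((measurable_clip R).comp (by fun_prop :
      Measurable fun z : Trajectory S A => (z (t + 1)).1)).const_mul _).aestronglyMeasurable)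
    (fun t => .of_forall fun z => norm_discounted_clip_le hγ0 hR0 t _)
    (.of_forall fun _ => (hasSum_discount hγ0 hγ1 R).summable) (integrable_const _)
    (.of_forall fun z => hasSum_boundedReturn hγ0 hγ1 hR0 z)
  rw [← J_eq_integral_boundedReturn hR] at h
  refine Eq.mp (congrArg (fun u : ℕ → ℝ => HasSum u (J M pol γ θ p)) (funext fun t => ?_)) h
  rw [integral_const_mul]
  congr 1
  have hmt : Measurable fun z : Trajectory S A => clip R (z (t + 1)).1 :=
    (measurable_clip R).comp (by fun_prop)
  have hmc : Measurable fun z : ℕ → ChainState Θ P S A => clip R (z (t + 1)).2.1 :=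
    hmt.comp hm
  have hi : Integrable (fun z : ℕ → ChainState Θ P S A => clip R (z (t + 1)).2.1)
      ((chainKernel M pol ∘ₖ startKernel M pol) (θ, p)) :=
    Integrable.of_bound hmc.aestronglyMeasurable R (.of_forall fun z => abs_clip_le hR0 _)
  rw [trajKernel, Kernel.map_apply _ hm, integral_map hm.aemeasurable hmt.aestronglyMeasurable,
    Kernel.integral_comp hi]
  refine integral_congr_ae (.of_forall fun x => ?_)
  exact integral_chainKernel hcm (fun x => abs_clip_le hR0 _) (t + 1) x

/-- Lipschitz constant of the expected return in the environment parameter. -/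
def returnLip (γ R LT LR : ℝ) : ℝ := ∑' t : ℕ, γ ^ t * (LR + (t + 1) * (2 * R * LT))

theorem summable_returnLip (hγ0 : 0 ≤ γ) (hγ1 : γ < 1) (R LT LR : ℝ) :
    Summable fun t : ℕ => γ ^ t * (LR + (t + 1) * (2 * R * LT)) := by
  have h1 : Summable fun t : ℕ => γ ^ t := summable_geometric_of_lt_one hγ0 hγ1
  have h2 : Summable fun t : ℕ => (t : ℝ) ^ 1 * γ ^ t :=
    summable_pow_mul_geometric_of_norm_lt_one 1 (by rwa [Real.norm_eq_abs, abs_of_nonneg hγ0])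
  refine ((h1.mul_right (LR + 2 * R * LT)).add (h2.mul_right (2 * R * LT))).congr fun t => ?_
  ring

theorem abs_J_sub_le {LT LR : ℝ} (hγ0 : 0 ≤ γ) (hγ1 : γ < 1) (hR0 : 0 ≤ R)
    (hR : BoundedReward M R) (hT : TransitionLipschitz M LT) (hLR : RewardLipschitz M LR) (θ : Θ)
    (p p' : P) : |J M pol γ θ p - J M pol γ θ p'| ≤ returnLip γ R LT LR * dist p p' := by
  have h := (hasSum_J (pol := pol) hγ0 hγ1 hR0 hR θ p).sub (hasSum_J (pol := pol) hγ0 hγ1 hR0 hR θ p')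
  rw [← h.tsum_eq, ← Real.norm_eq_abs]
  refine tsum_of_norm_bounded ((summable_returnLip hγ0 hγ1 R LT LR).hasSum.mul_right _)
    fun t => ?_
  rw [← mul_sub, norm_mul, norm_pow, Real.norm_eq_abs γ, abs_of_nonneg hγ0, mul_assoc]
  refine mul_le_mul_of_nonneg_left ?_ (pow_nonneg hγ0 t)
  have hu := lipObservable_iterate (pol := pol) hR0 hR hT hLR t
  set u := (stepOp M pol)^[t + 1] fun x => clip R x.2.1
  -- The start records `(θ, q)` deterministically, so the parameter can be made explicit in the
  -- integrand.
  have hstart : ∀ q : P, ∫ x, u x ∂(startKernel M pol (θ, q)) =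
      ∫ x, u ((θ, q), x.2) ∂(startKernel M pol (θ, q)) := by
    intro q
    have hm : Measurable fun x : ChainState Θ P S A => u ((θ, q), x.2) :=
      hu.measurable.comp (by fun_prop)
    rw [startKernel, Kernel.prod_apply, Kernel.id_apply, Measure.dirac_prod,
      integral_map measurable_prodMk_left.aemeasurable hu.measurable.aestronglyMeasurable,
      integral_map measurable_prodMk_left.aemeasurable hm.aestronglyMeasurable]
  rw [hstart, hstart]
  exact integral_startKernel_congr (f := fun y => u ((θ, p), y)) (g := fun y => u ((θ, p'), y))
    (hu.measurable.comp measurable_prodMk_left) (hu.measurable.comp measurable_prodMk_left)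
    (fun y => hu.bound _) (fun y => hu.bound _) (fun y => hu.lip θ p p' _ _ _ _) θ p p'

end Lipschitz

/-! ### Random errors of a run: noise within clusters and mixing between clusters. -/

section Run

variable {S A Θ : Type*} [MeasurableSpace S] [MeasurableSpace A] [MeasurableSpace Θ] {d : ℕ}
  {P : Set (EuclideanSpace ℝ (Fin d))}

/-- Distribution function of the return of `π_θ` under a random environment parameter. -/
def returnCdf (M : PMDP S A P) (pol : Kernel (Θ × S) A) [IsMarkovKernel pol] (γ : ℝ) (θ : Θ)
    (x : ℝ) : ℝ :=
  M.D.real {p | J M pol γ θ p ≤ x}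

variable {M : PMDP S A P} {pol : Kernel (Θ × S) A} [IsMarkovKernel pol] {γ R : ℝ}

theorem measurable_returnCdf (hJ : Measurable fun x : Θ × P => J M pol γ x.1 x.2) :
    Measurable fun y : Θ × ℝ => returnCdf M pol γ y.1 y.2 := by
  have hset : MeasurableSet {y : (Θ × ℝ) × P | J M pol γ y.1.1 y.2 ≤ y.1.2} :=
    measurableSet_le (hJ.comp (by fun_prop : Measurable fun y : (Θ × ℝ) × P => (y.1.1, y.2)))
      (by fun_prop)
  exact (measurable_measure_prodMk_left hset).ennreal_toReal

theorem returnCdf_mem_Icc (θ : Θ) (x : ℝ) : returnCdf M pol γ θ x ∈ Set.Icc (0 : ℝ) 1 :=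
  ⟨measureReal_nonneg, measureReal_le_one⟩

variable {n m : ℕ} {Ω : Type*} [mΩ : MeasurableSpace Ω] {μ : Measure Ω}
  (r : DFRun M pol n m μ)

namespace DFRun

theorem measurable_p (hn : 0 < n) (t : ℕ) {k : ℕ} (hk : k < m) : Measurable (r.p t k) := by
  -- Cluster `t` is number `t % n` of iteration `t / n`.
  have h := r.p_hist (t / n) (t % n) k (Nat.mod_lt _ hn) hk
  rw [Nat.div_add_mod'] at h
  exact h.mono (r.hist.le _) le_rfl

theorem measurable_ξ {i : ℕ} {ϑ : Ω → Θ} (hϑ : Measurable[r.hist i] ϑ) {j k : ℕ} (hj : j < n)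
    (hk : k < m) : Measurable fun ω => r.ξ (ϑ ω) (i * n + j) k ω :=
  (r.execution i ϑ hϑ j k hj hk).1

/-- The history of the `k`-th execution of cluster `j` of iteration `i`, including its environment
parameter, when the policy with parameter `ϑ` is executed. -/
abbrev past (i : ℕ) (ϑ : Ω → Θ) (j k : ℕ) : MeasurableSpace Ω :=
  executionPast (r.hist i) m (fun j' k' => r.p (i * n + j') k')
    (fun j' k' ω => r.ξ (ϑ ω) (i * n + j') k' ω) j k

variable {i : ℕ} {ϑ : Ω → Θ}

theorem past_le (hϑ : Measurable[r.hist i] ϑ) {j k : ℕ} (hj : j < n) (hk : k < m) :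
    r.past i ϑ j k ≤ mΩ := by
  have hn : 0 < n := (Nat.zero_le j).trans_lt hj
  refine sup_le (sup_le (r.hist.le i) ?_) (r.measurable_p hn _ hk).comap_le
  refine iSup_le fun j' => iSup_le fun k' => iSup_le fun h => sup_le ?_ ?_
  · exact (r.measurable_p hn _ h.1).comap_le
  · exact (r.measurable_ξ hϑ (by omega) h.1).comap_le

theorem measurable_past_policy (hϑ : Measurable[r.hist i] ϑ) (j k : ℕ) :
    Measurable[r.past i ϑ j k] ϑ :=
  hϑ.mono (le_sup_of_le_left le_sup_left) le_rfl

theorem measurable_past_current (i : ℕ) (ϑ : Ω → Θ) (j k : ℕ) :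
    Measurable[r.past i ϑ j k] (r.p (i * n + j) k) :=
  (comap_measurable _).mono le_sup_right le_rfl

theorem measurable_past_earlier (i : ℕ) (ϑ : Ω → Θ) (j : ℕ) {k k' : ℕ} (hk : k' < k)
    (hk' : k' < m) : Measurable[r.past i ϑ j k] (r.p (i * n + j) k') ∧
      Measurable[r.past i ϑ j k] fun ω => r.ξ (ϑ ω) (i * n + j) k' ω := by
  have hle : MeasurableSpace.comap (r.p (i * n + j) k') inferInstance ⊔
      MeasurableSpace.comap (fun ω => r.ξ (ϑ ω) (i * n + j) k' ω) inferInstance ≤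
      r.past i ϑ j k := by
    refine le_sup_of_le_left (le_sup_of_le_right ?_)
    refine le_iSup_of_le j (le_iSup_of_le k' (le_iSup_of_le ⟨hk', Or.inr ⟨rfl, hk⟩⟩ le_rfl))
  exact ⟨(comap_measurable _).mono (le_sup_left.trans hle) le_rfl,
    (comap_measurable _).mono (le_sup_right.trans hle) le_rfl⟩

/-- Average deviation of the returns of a cluster from their expectations. -/
def noise (γ R : ℝ) (i : ℕ) (ϑ : Ω → Θ) (j : ℕ) (ω : Ω) : ℝ :=
  (∑ k ∈ Finset.range m, (boundedReturn γ R (r.ξ (ϑ ω) (i * n + j) k ω) -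
    J M pol γ (ϑ ω) (r.p (i * n + j) k ω))) / m

/-- The added `1` keeps the bound positive when `R = 0`, as Azuma's inequality requires. -/
theorem abs_deviation_le (hγ0 : 0 ≤ γ) (hγ1 : γ < 1) (hR0 : 0 ≤ R) (hR : BoundedReward M R)
    (θ : Θ) (p : P) (z : Trajectory S A) :
    |boundedReturn γ R z - J M pol γ θ p| ≤ 2 * (R / (1 - γ) + 1) := by
  have h1 := abs_le.1 (abs_boundedReturn_le hγ0 hγ1 hR0 z)
  have h2 := abs_le.1 (abs_J_le (pol := pol) hγ0 hγ1 hR0 hR θ p)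
  exact abs_le.2 ⟨by linarith [h1.1, h2.2], by linarith [h1.2, h2.1]⟩

theorem measurable_noise (hγ0 : 0 ≤ γ) (hγ1 : γ < 1) (hR0 : 0 ≤ R) (hR : BoundedReward M R)
    (hϑ : Measurable[r.hist i] ϑ) {j : ℕ} (hj : j < n) :
    Measurable (r.noise γ R i ϑ j) := by
  have hn : 0 < n := (Nat.zero_le j).trans_lt hj
  refine (Finset.measurable_fun_sum _ fun k hk => ?_).div_const _
  have hk := Finset.mem_range.1 hk
  exact ((measurable_boundedReturn hγ0 hγ1 hR0).comp (r.measurable_ξ hϑ hj hk)).sub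
    ((measurable_J hγ0 hγ1 hR0 hR).comp ((hϑ.mono (r.hist.le i) le_rfl).prodMk
      (r.measurable_p hn _ hk)))

theorem abs_noise_le (hγ0 : 0 ≤ γ) (hγ1 : γ < 1) (hR0 : 0 ≤ R) (hR : BoundedReward M R)
    (j : ℕ) (ω : Ω) : |r.noise γ R i ϑ j ω| ≤ 2 * (R / (1 - γ) + 1) := by
  have hC : 0 ≤ R / (1 - γ) := div_nonneg hR0 (by linarith)
  rw [noise, abs_div, Nat.abs_cast]
  refine div_le_of_le_mul₀ (Nat.cast_nonneg _) (by linarith) ?_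
  refine (Finset.abs_sum_le_sum_abs _ _).trans ?_
  refine (Finset.sum_le_sum fun k _ => abs_deviation_le hγ0 hγ1 hR0 hR _ _ _).trans_eq ?_
  simp [mul_comm]

/-- Given the execution past, which includes the current parameter and determines the policy, the
return has conditional mean `J`. The deviations are therefore bounded martingale differences along
the cluster, and averaging leaves a variance proxy of order `1 / m`. -/
theorem expMomentBound_noise [IsProbabilityMeasure μ] (hγ0 : 0 ≤ γ) (hγ1 : γ < 1)
    (hR0 : 0 ≤ R) (hR : BoundedReward M R) (hϑ : Measurable[r.hist i] ϑ) {j : ℕ} (hj : j < n) :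
    ExpMomentBound μ (r.noise γ R i ϑ j) 1
      (m * (2 * (R / (1 - γ) + 1)) ^ 2 / 2 / (m : ℝ) ^ 2) := by
  have hJm := measurable_J (pol := pol) hγ0 hγ1 hR0 hR
  have hbm : Measurable (boundedReturn γ R : Trajectory S A → ℝ) :=
    measurable_boundedReturn hγ0 hγ1 hR0
  have hC : 0 ≤ R / (1 - γ) := div_nonneg hR0 (by linarith)
  have hn : 0 < n := (Nat.zero_le j).trans_lt hj
  refine ExpMomentBound.div_const (expMomentBound_sum μ (r.past i ϑ j) (fun k ω =>
    boundedReturn γ R (r.ξ (ϑ ω) (i * n + j) k ω) - J M pol γ (ϑ ω) (r.p (i * n + j) k ω))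
    (by linarith) m (fun k hk => r.past_le hϑ hj hk) (fun k hk => ?_) (fun k hk k' hk' => ?_)
    (fun k hk => .of_forall fun ω => abs_deviation_le hγ0 hγ1 hR0 hR _ _ _) (fun k hk => ?_)) m
  · exact ((hbm.comp (r.measurable_ξ hϑ hj hk)).sub (hJm.comp ((hϑ.mono (r.hist.le i)
      le_rfl).prodMk (r.measurable_p hn _ hk)))).stronglyMeasurable
  · obtain ⟨h1, h2⟩ := r.measurable_past_earlier i ϑ j hk' (hk'.trans hk)
    exact ((hbm.comp h2).sub (hJm.comp
      ((r.measurable_past_policy hϑ j k).prodMk h1))).stronglyMeasurable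
  · have hle := r.past_le hϑ hj hk
    have hφ : Measurable[r.past i ϑ j k] fun ω => (ϑ ω, r.p (i * n + j) k ω) :=
      (r.measurable_past_policy hϑ j k).prodMk (r.measurable_past_current i ϑ j k)
    obtain ⟨hξ, hlaw⟩ := r.execution i ϑ hϑ j k hj hk
    have h1 := condExp_comp_of_isCondLaw (trajKernel M pol) hφ hle hξ hlaw hbm
      (abs_boundedReturn_le hγ0 hγ1 hR0)
    have hJs : StronglyMeasurable[r.past i ϑ j k]
        fun ω => J M pol γ (ϑ ω) (r.p (i * n + j) k ω) := (hJm.comp hφ).stronglyMeasurable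
    have hJi : Integrable (fun ω => J M pol γ (ϑ ω) (r.p (i * n + j) k ω)) μ :=
      Integrable.of_bound (hJs.mono hle).aestronglyMeasurable (R / (1 - γ))
        (.of_forall fun ω => abs_J_le hγ0 hγ1 hR0 hR _ _)
    have hbi : Integrable (fun ω => boundedReturn γ R (r.ξ (ϑ ω) (i * n + j) k ω)) μ :=
      Integrable.of_bound (hbm.comp hξ).aestronglyMeasurable (R / (1 - γ))
        (.of_forall fun ω => abs_boundedReturn_le hγ0 hγ1 hR0 _)
    refine (condExp_sub hbi hJi _).trans ?_
    rw [condExp_of_stronglyMeasurable hle hJs hJi]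
    filter_upwards [h1] with ω hω
    rw [Pi.sub_apply, hω, J_eq_integral_boundedReturn hR]
    simp

/-! ### Mixing of the cluster parameters -/

/-- Deviation of the indicator of a return at most `x` from its stationary probability. -/
def rankDeviation (γ : ℝ) (i : ℕ) (ϑ : Ω → Θ) (x : ℝ) (j : ℕ) (ω : Ω) : ℝ :=
  (if J M pol γ (ϑ ω) (r.p (i * n + j) 0 ω) ≤ x then (1 : ℝ) else 0) - returnCdf M pol γ (ϑ ω) x

theorem abs_rankDeviation_le (γ : ℝ) (i : ℕ) (ϑ : Ω → Θ) (x : ℝ) (j : ℕ) (ω : Ω) :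
    |r.rankDeviation γ i ϑ x j ω| ≤ 1 := by
  have h := returnCdf_mem_Icc (M := M) (pol := pol) (γ := γ) (ϑ ω) x
  rw [rankDeviation]
  split_ifs
  · exact abs_le.2 ⟨by linarith [h.2], by linarith [h.1]⟩
  · exact abs_le.2 ⟨by linarith [h.2], by linarith [h.1]⟩

theorem observed_le (hn : 0 < n) (hm : 0 < m) (i j : ℕ) : r.observed i j ≤ mΩ :=
  sup_le (r.hist.le i) (iSup_le fun _ => iSup_le fun _ => (r.measurable_p hn _ hm).comap_le)

theorem observed_mono (i : ℕ) {j j' : ℕ} (h : j ≤ j') : r.observed i j ≤ r.observed i j' := by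
  refine sup_le le_sup_left (iSup_le fun k => iSup_le fun hk => le_sup_of_le_right ?_)
  exact le_iSup_of_le k (le_iSup_of_le (hk.trans h) le_rfl)

theorem stronglyMeasurable_rankDeviation (hJ : Measurable fun x : Θ × P => J M pol γ x.1 x.2)
    (hϑ : Measurable[r.hist i] ϑ) (x : ℝ) {j j' : ℕ} (h : j' ≤ j) :
    StronglyMeasurable[r.observed i j] (r.rankDeviation γ i ϑ x j') := by
  have h1 : Measurable[r.observed i j] ϑ := hϑ.mono le_sup_left le_rfl
  have h2 : Measurable[r.observed i j] (r.p (i * n + j') 0) :=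
    (comap_measurable _).mono (le_sup_of_le_right (le_iSup_of_le j' (le_iSup_of_le h le_rfl)))
      le_rfl
  refine Measurable.stronglyMeasurable (Measurable.sub ?_ ?_)
  · exact Measurable.ite (measurableSet_le (hJ.comp (h1.prodMk h2)) measurable_const)
      measurable_const measurable_const
  · exact (measurable_returnCdf hJ).comp (h1.prodMk measurable_const)

/-- The conditional expectation of the future rank deviations is controlled by the mixing
assumption. -/
theorem abs_condExp_future_le [IsProbabilityMeasure μ] (hn : 0 < n) (hm : 0 < m)
    (hJ : Measurable fun x : Θ × P => J M pol γ x.1 x.2)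
    (hϑ : Measurable[r.hist i] ϑ) {B : ℝ} (hB : r.PosteriorMixing B) (x : ℝ) {j : ℕ} (hj : j < n)
    (N : ℕ) :
    ∀ᵐ ω ∂μ, |(μ[∑ s ∈ Finset.range N, r.rankDeviation γ i ϑ x (j + s)|r.observed i j]) ω| ≤
      max B 0 := by
  obtain ⟨Q, hQ, hsum⟩ := hB i j hj
  have hle := r.observed_le hn hm i j
  have hϑo : Measurable[r.observed i j] ϑ := hϑ.mono le_sup_left le_rfl
  have hint : ∀ s, Integrable (r.rankDeviation γ i ϑ x (j + s)) μ := fun s =>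
    Integrable.of_bound ((r.stronglyMeasurable_rankDeviation hJ hϑ x le_rfl).mono
      (r.observed_le hn hm i _)).aestronglyMeasurable 1
      (.of_forall fun ω => r.abs_rankDeviation_le γ i ϑ x _ ω)
  have hset : MeasurableSet {y : Θ × P | J M pol γ y.1 y.2 ≤ x} :=
    measurableSet_le hJ measurable_const
  have hF : StronglyMeasurable[r.observed i j] fun ω => returnCdf M pol γ (ϑ ω) x :=
    ((measurable_returnCdf hJ).comp (hϑo.prodMk measurable_const)).stronglyMeasurable
  have hFi : Integrable (fun ω => returnCdf M pol γ (ϑ ω) x) μ :=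
    Integrable.of_bound (hF.mono hle).aestronglyMeasurable 1 (.of_forall fun ω => by
      rw [Real.norm_eq_abs, abs_of_nonneg (returnCdf_mem_Icc _ _).1]
      exact (returnCdf_mem_Icc _ _).2)
  have hterm : ∀ s, ∀ᵐ ω ∂μ, |(μ[r.rankDeviation γ i ϑ x (j + s)|r.observed i j]) ω| ≤
      tv M.D (Q s ω) := by
    intro s
    have hq : Measurable (r.p (i * n + j + s) 0) := r.measurable_p hn _ hm
    have hq' : Measurable fun ω => (ϑ ω, r.p (i * n + j + s) 0 ω) :=
      (hϑ.mono (r.hist.le i) le_rfl).prodMk hq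
    set E : Set Ω := {ω | J M pol γ (ϑ ω) (r.p (i * n + j + s) 0 ω) ≤ x} with hE
    -- The policy is known given the observations and can be frozen; replacing the posterior by
    -- `M.D` then costs one total variation distance.
    have h1 : μ⟦E | r.observed i j⟧ =ᵐ[μ] fun ω => (Q s ω).real {p | J M pol γ (ϑ ω) p ≤ x} :=
      (hQ s).condExp_prodMk hle hq hϑo hset
    have e : r.rankDeviation γ i ϑ x (j + s) =
        (E.indicator fun _ => (1 : ℝ)) - fun ω => returnCdf M pol γ (ϑ ω) x := by
      funext ω
      simp only [rankDeviation, Pi.sub_apply, Set.indicator, hE, Set.mem_ofPred_eq, add_assoc]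
    have hEm : MeasurableSet E := hq' hset
    have h2 := condExp_sub (m := r.observed i j)
      ((integrable_const (μ := μ) (1 : ℝ)).indicator hEm) hFi
    rw [condExp_of_stronglyMeasurable hle hF hFi] at h2
    rw [e]
    filter_upwards [h1, h2] with ω hω1 hω2
    have := (hQ s).1 ω
    have hset' : MeasurableSet {p | J M pol γ (ϑ ω) p ≤ x} := measurable_prodMk_left hset
    rw [hω2, Pi.sub_apply, hω1, returnCdf, abs_sub_comm]
    exact abs_measureReal_sub_le_tv M.D (Q s ω) hset'
  have hs := condExp_finsetSum (s := Finset.range N)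
    (f := fun s => r.rankDeviation γ i ϑ x (j + s)) (fun s _ => hint s) (r.observed i j)
  filter_upwards [hs, ae_all_iff.2 hterm, hsum] with ω hω1 hω2 hω3
  rw [hω1, Finset.sum_apply]
  have hprob : ∀ s, IsProbabilityMeasure (Q s ω) := fun s => (hQ s).1 ω
  calc |∑ s ∈ Finset.range N, (μ[r.rankDeviation γ i ϑ x (j + s)|r.observed i j]) ω|
      ≤ ∑ s ∈ Finset.range N, tv M.D (Q s ω) :=
        (Finset.abs_sum_le_sum_abs _ _).trans (Finset.sum_le_sum fun s _ => hω2 s)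
    _ ≤ max B 0 := by
        have h1 : ENNReal.ofReal (∑ s ∈ Finset.range N, tv M.D (Q s ω)) ≤ ENNReal.ofReal B := by
          rw [ENNReal.ofReal_sum_of_nonneg fun s _ => tv_nonneg _ _]
          exact (ENNReal.sum_le_tsum _).trans hω3
        -- A negative `B` acts as `0` under `ENNReal.ofReal`, whence `max B 0`.
        rcases le_or_gt B 0 with h | h
        · rw [ENNReal.ofReal_of_nonpos h] at h1
          exact (ENNReal.ofReal_eq_zero.1 (nonpos_iff_eq_zero.1 h1)).trans (le_max_right _ _)
        · exact ((ENNReal.ofReal_le_ofReal_iff h.le).1 h1).trans (le_max_left _ _)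

/-- Exponential moments of the deviation of the empirical distribution function of the returns
under the first environment parameters of the clusters. -/
theorem expMomentBound_rankDeviation [IsProbabilityMeasure μ] (hn : 0 < n) (hm : 0 < m)
    (hJ : Measurable fun x : Θ × P => J M pol γ x.1 x.2)
    (hϑ : Measurable[r.hist i] ϑ) {B : ℝ} (hB : r.PosteriorMixing B) (x : ℝ) :
    ExpMomentBound μ (fun ω => (∑ j ∈ Finset.range n, r.rankDeviation γ i ϑ x j ω) / n)
      (Real.exp (1 / 2)) (n * (2 * max B 0 + 1) ^ 2 / 2 / (n : ℝ) ^ 2) := by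
  set B' := max B 0 with hB'
  have hB0 : 0 ≤ B' := le_max_right _ _
  -- After this renaming there are `n + 1` clusters, and `G n` already knows all their first
  -- parameters: the martingale has `n` increments and a starting value.
  obtain ⟨n, rfl⟩ : ∃ n', n = n' + 1 := ⟨n - 1, by omega⟩
  set X := r.rankDeviation γ i ϑ x with hX
  set G := r.observed i with hG
  have hle : ∀ j, G j ≤ mΩ := fun j => r.observed_le hn hm i j
  have hXs : ∀ {j' j}, j' ≤ j → StronglyMeasurable[G j] (X j') := fun h =>
    r.stronglyMeasurable_rankDeviation hJ hϑ x h
  have hXi : ∀ j, Integrable (X j) μ := fun j =>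
    Integrable.of_bound ((hXs (le_refl j)).mono (hle j)).aestronglyMeasurable 1
      (.of_forall fun ω => r.abs_rankDeviation_le γ i ϑ x _ ω)
  set T : Ω → ℝ := ∑ j ∈ Finset.range (n + 1), X j with hT
  have hTi : Integrable T μ := integrable_finsetSum' _ fun j _ => hXi j
  have hpastm : ∀ j, StronglyMeasurable[G j] (∑ y ∈ Finset.range j, X y) := fun j =>
    Finset.stronglyMeasurable_sum _ fun y hy => hXs (Finset.mem_range.1 hy).le
  -- The Doob martingale of the total differs from the sum already observed by the expected future,
  -- at most `B'`.
  have hrem : ∀ j, j < n + 1 → ∀ᵐ ω ∂μ,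
      |(μ[T|G j]) ω - (∑ y ∈ Finset.range j, X y) ω| ≤ B' := by
    intro j hj
    have hsplit : T = ∑ y ∈ Finset.range j, X y +
        ∑ s ∈ Finset.range (n + 1 - j), X (j + s) := by
      rw [hT, ← Finset.sum_range_add]
      congr 2
      omega
    have h1 : μ[T|G j] =ᵐ[μ] _ := hsplit ▸ condExp_add
      (integrable_finsetSum' _ fun y _ => hXi y) (integrable_finsetSum' _ fun s _ => hXi (j + s))
      (G j)
    rw [condExp_of_stronglyMeasurable (hle j) (hpastm j)
      (integrable_finsetSum' _ fun y _ => hXi y)] at h1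
    filter_upwards [h1, r.abs_condExp_future_le hn hm hJ hϑ hB x hj (n + 1 - j)] with ω hω1 hω2
    rw [hω1, Pi.add_apply, add_sub_cancel_left]
    exact hω2
  -- Consecutive values are within `B'` of partial sums that differ by a single term of size at most
  -- `1`, so increments are at most `2 * B' + 1`.
  have hmart := expMomentBound_sum μ G (fun j => μ[T|G (j + 1)] - μ[T|G j])
    (K := 2 * B' + 1) (by linarith) n (fun j _ => hle j)
    (fun j _ => (stronglyMeasurable_condExp.mono (hle _)).sub
      (stronglyMeasurable_condExp.mono (hle _)))
    (fun j _ k hk => (stronglyMeasurable_condExp.mono (r.observed_mono i hk)).sub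
      (stronglyMeasurable_condExp.mono (r.observed_mono i hk.le)))
    (fun j hj => by
      filter_upwards [hrem j (by omega), hrem (j + 1) (by omega)] with ω h1 h2
      have h3 := r.abs_rankDeviation_le γ i ϑ x j ω
      rw [Finset.sum_range_succ, Pi.add_apply] at h2
      rw [Pi.sub_apply]
      obtain ⟨h1, h1'⟩ := abs_le.1 h1
      obtain ⟨h2, h2'⟩ := abs_le.1 h2
      obtain ⟨h3, h3'⟩ := abs_le.1 h3
      exact abs_le.2 ⟨by linarith, by linarith⟩)
    (fun j hj => by
      refine (condExp_sub integrable_condExp integrable_condExp _).trans ?_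
      have h1 : μ[μ[T|G (j + 1)]|G j] =ᵐ[μ] μ[T|G j] :=
        condExp_condExp_of_le (r.observed_mono i (Nat.le_succ j)) (hle (j + 1))
      have h2 := condExp_condExp_of_le (f := T) (μ := μ) (le_refl (G j)) (hle j)
      filter_upwards [h1, h2] with ω h1 h2
      rw [Pi.sub_apply, h1, h2]
      simp)
  -- The starting value need not be centred. Its bound `B'` is relaxed to that of the increments, so
  -- that it counts as one more term in the variance proxy.
  have h0 : ∀ᵐ ω ∂μ, |(μ[T|G 0]) ω| ≤ 2 * B' + 1 := by
    filter_upwards [hrem 0 (by omega)] with ω hω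
    simp only [Finset.range_zero, Finset.sum_empty, Pi.zero_apply, sub_zero] at hω
    linarith
  have hTn : μ[T|G n] = T := condExp_of_stronglyMeasurable (hle n)
    (Finset.stronglyMeasurable_sum _ fun y hy =>
      hXs (Nat.lt_succ_iff.1 (Finset.mem_range.1 hy))) hTi
  have h := (hmart.add_bounded h0).div_const ((n + 1 : ℕ) : ℝ)
  have e1 : ∀ ω, (∑ j ∈ Finset.range n, (μ[T|G (j + 1)] - μ[T|G j]) ω) + (μ[T|G 0]) ω =
      ∑ j ∈ Finset.range (n + 1), X j ω := by
    intro ω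
    simp only [Pi.sub_apply]
    rw [Finset.sum_range_sub (fun j => (μ[T|G j]) ω), sub_add_cancel, hTn, hT, Finset.sum_apply]
  simp_rw [e1] at h
  convert h using 1
  · ring
  · push_cast
    ring

end DFRun

end Run

/-! ### Deviation of the evaluated metric: pathwise bound and tails. -/

section Deviation

variable {S A Θ : Type*} [MeasurableSpace S] [MeasurableSpace A] [MeasurableSpace Θ] {d : ℕ}
  {P : Set (EuclideanSpace ℝ (Fin d))} {M : PMDP S A P} {pol : Kernel (Θ × S) A}
  [IsMarkovKernel pol] {γ R : ℝ} {W : ℝ → ℝ}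

theorem abs_uorMetric_le (hW : AntitoneOn W (Set.Icc 0 1))
    (hW0 : ∀ x ∈ Set.Icc (0 : ℝ) 1, 0 ≤ W x) {C : ℝ} (hC : ∀ θ p, |J M pol γ θ p| ≤ C) (θ : Θ) :
    |uorMetric M pol γ W θ| ≤ C * W 0 := by
  refine abs_integral_le_of_abs_le _ fun p => ?_
  have hr : rank M pol γ θ p ∈ Set.Icc (0 : ℝ) 1 := ⟨measureReal_nonneg, measureReal_le_one⟩
  rw [abs_mul, abs_of_nonneg (hW0 _ hr)]
  exact mul_le_mul (hC θ p) (weight_le hW hr) (hW0 _ hr) ((abs_nonneg _).trans (hC θ p))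

/-- Deviation of the sorted metric from the UOR metric. -/
theorem abs_sortedMetric_sub_uorMetric_le (hW : AntitoneOn W (Set.Icc 0 1))
    (hW0 : ∀ x ∈ Set.Icc (0 : ℝ) 1, 0 ≤ W x) (hJ : Measurable fun x : Θ × P => J M pol γ x.1 x.2)
    {C : ℝ} (hC0 : 0 ≤ C) (hC : ∀ θ p, |J M pol γ θ p| ≤ C) (hties : NoTies M pol γ) {n : ℕ}
    (hn : 0 < n) (θ : Θ) (v : Fin n → ℝ) (hv : ∀ j, |v j| ≤ C) :
    |sortedMetric W n v - uorMetric M pol γ W θ| ≤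
      W 0 * ∫ x in (-C)..C, |empCdf v x - returnCdf M pol γ θ x| := by
  have hJθ : Measurable (J M pol γ θ) := hJ.comp measurable_prodMk_left
  set ν := M.D.map (J M pol γ θ) with hν
  have : IsProbabilityMeasure ν := Measure.isProbabilityMeasure_map hJθ.aemeasurable
  have : NullSingletonClass ν := ⟨fun x => by
    rw [hν, Measure.map_apply hJθ (measurableSet_singleton x)]
    exact hties θ x⟩
  have hcdf : ∀ x, cdf ν x = returnCdf M pol γ θ x := fun x => by
    rw [cdf_eq_real, hν, map_measureReal_apply hJθ measurableSet_Iic]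
    rfl
  have hνC : ∀ᵐ y ∂ν, |y| ≤ C := by
    have hs : MeasurableSet {y : ℝ | |y| ≤ C} := measurableSet_le measurable_norm measurable_const
    rw [hν, ae_map_iff hJθ.aemeasurable hs]
    exact .of_forall (hC θ)
  -- The rank of a parameter is the distribution function of the returns evaluated at its own
  -- return.
  have huor : uorMetric M pol γ W θ = ∫ y, y * W (cdf ν y) ∂ν := by
    have hWm : Measurable fun y => y * W (cdf ν y) :=
      measurable_id.mul (weight_cdf_antitone ν hW).measurable
    rw [hν, integral_map hJθ.aemeasurable hWm.aestronglyMeasurable]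
    refine integral_congr_ae (.of_forall fun p => ?_)
    dsimp only
    rw [hcdf]
    rfl
  have := abs_sortedMetric_sub_le ν hW hW0 hC0 hνC hn v hv
  rw [huor]
  simpa only [hcdf] using this

theorem monotone_returnCdf (θ : Θ) : Monotone (returnCdf M pol γ θ) := fun _ _ h =>
  measureReal_mono fun _ hp => le_trans hp h

variable {n m : ℕ} {Ω : Type*} [mΩ : MeasurableSpace Ω] {μ : Measure Ω}
  (r : DFRun M pol n m μ)

namespace DFRun

theorem ae_dist_le_of_slowDrift {δ : ℝ} (hr : r.SlowDrift δ) :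
    ∀ᵐ ω ∂μ, ∀ t k, k < m → dist (r.p t k ω) (r.p t 0 ω) ≤ k * δ := by
  have h : ∀ᵐ ω ∂μ, ∀ t k, k + 1 < m → dist (r.p t k ω) (r.p t (k + 1) ω) < δ := by
    rw [ae_all_iff]; intro t
    rw [ae_all_iff]; intro k
    by_cases hk : k + 1 < m
    · filter_upwards [hr t k hk] with ω hω _ using hω
    · exact .of_forall fun ω h => absurd h hk
  filter_upwards [h] with ω hω t k hk
  induction k with
  | zero => simp
  | succ k ih =>
    have h1 := ih (by omega)
    have h2 := hω t k hk
    have h3 := dist_triangle (r.p t (k + 1) ω) (r.p t k ω) (r.p t 0 ω)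
    rw [dist_comm (r.p t (k + 1) ω) (r.p t k ω)] at h3
    push_cast
    linarith

/-- The exceptional null set depends on the choice `ϑ`; no statement uniform over all policies is
made. -/
theorem ae_clusterMean_eq [IsProbabilityMeasure μ] (hR : BoundedReward M R) {i : ℕ} {ϑ : Ω → Θ}
    (hϑ : Measurable[r.hist i] ϑ) :
    ∀ᵐ ω ∂μ, ∀ j < n, r.clusterMean γ (i * n + j) (ϑ ω) ω =
      (∑ k ∈ Finset.range m, boundedReturn γ R (r.ξ (ϑ ω) (i * n + j) k ω)) / m := by
  have h : ∀ᵐ ω ∂μ, ∀ j k, j < n → k < m →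
      r.ξ (ϑ ω) (i * n + j) k ω ∈ {z : Trajectory S A | ∀ t : ℕ, |(z (t + 1)).1| ≤ R} := by
    rw [ae_all_iff]; intro j
    rw [ae_all_iff]; intro k
    by_cases hjk : j < n ∧ k < m
    · obtain ⟨hξ, hlaw⟩ := r.execution i ϑ hϑ j k hjk.1 hjk.2
      filter_upwards [hlaw.ae_mem (r.past_le hϑ hjk.1 hjk.2) hξ (measurableSet_bounded_rewards R)
        fun ω => ae_trajKernel_abs_reward_le hR _] with ω hω _ _ using hω
    · exact .of_forall fun ω h1 h2 => absurd ⟨h1, h2⟩ hjk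
  filter_upwards [h] with ω hω j hj
  rw [clusterMean]
  congr 1
  exact Finset.sum_congr rfl fun k hk => (boundedReturn_eq (hω j k hj (Finset.mem_range.1 hk))).symm

/-- Deviation of the evaluated metric from the UOR metric. -/
theorem ae_abs_metric_sub_uorMetric_le [IsProbabilityMeasure μ] (hn : 0 < n) (hm : 0 < m)
    (hW : AntitoneOn W (Set.Icc 0 1)) (hW0 : ∀ x ∈ Set.Icc (0 : ℝ) 1, 0 ≤ W x)
    (hγ0 : 0 ≤ γ) (hγ1 : γ < 1) (hR0 : 0 ≤ R) (hR : BoundedReward M R) (hties : NoTies M pol γ)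
    {L : ℝ} (hL0 : 0 ≤ L) (hL : ∀ θ p p', |J M pol γ θ p - J M pol γ θ p'| ≤ L * dist p p')
    {δ : ℝ} (hδ : r.SlowDrift δ) (hδ0 : 0 ≤ δ) {i : ℕ} {ϑ : Ω → Θ} (hϑ : Measurable[r.hist i] ϑ) :
    ∀ᵐ ω ∂μ, |r.metric γ W i (ϑ ω) ω - uorMetric M pol γ W (ϑ ω)| ≤
      W 0 * ((∫ x in (-(R / (1 - γ) + 1))..(R / (1 - γ) + 1),
          |(∑ j ∈ Finset.range n, r.rankDeviation γ i ϑ x j ω) / n|) +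
        (∑ j : Fin n, |r.noise γ R i ϑ j ω|) / n + L * (m * δ)) := by
  set C := R / (1 - γ) + 1 with hCdef
  have hC' : 0 ≤ R / (1 - γ) := div_nonneg hR0 (by linarith)
  have hC0 : 0 ≤ C := by linarith
  have hCJ : ∀ θ p, |J M pol γ θ p| ≤ C := fun θ p =>
    (abs_J_le hγ0 hγ1 hR0 hR θ p).trans (by linarith)
  have hJm := measurable_J (pol := pol) hγ0 hγ1 hR0 hR
  have hn' : (0 : ℝ) < n := by exact_mod_cast hn
  have hm' : (0 : ℝ) < m := by exact_mod_cast hm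
  have hW00 : 0 ≤ W 0 := hW0 0 ⟨le_rfl, zero_le_one⟩
  filter_upwards [r.ae_clusterMean_eq (γ := γ) hR hϑ, r.ae_dist_le_of_slowDrift hδ] with ω h1 h2
  set u : Fin n → ℝ := fun j => r.clusterMean γ (i * n + j) (ϑ ω) ω with hu
  set v : Fin n → ℝ := fun j => J M pol γ (ϑ ω) (r.p (i * n + j) 0 ω) with hv
  have huC : ∀ j, |u j| ≤ C := by
    intro j
    rw [hu]
    dsimp only
    rw [h1 j j.2, abs_div, Nat.abs_cast]
    refine div_le_of_le_mul₀ hm'.le hC0 ((Finset.abs_sum_le_sum_abs _ _).trans ?_)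
    refine (Finset.sum_le_sum fun k _ => (abs_boundedReturn_le hγ0 hγ1 hR0 _).trans
      (by linarith : _ ≤ C)).trans_eq ?_
    simp [mul_comm]
  -- Inserting the exact returns under the observed parameters separates random noise from drift
  -- within the cluster.
  have huv : ∀ j, |u j - v j| ≤ |r.noise γ R i ϑ j ω| + L * (m * δ) := by
    intro j
    have e : u j - v j = r.noise γ R i ϑ j ω + (∑ k ∈ Finset.range m,
        (J M pol γ (ϑ ω) (r.p (i * n + j) k ω) - J M pol γ (ϑ ω) (r.p (i * n + j) 0 ω))) / m := by
      rw [hu, hv, noise]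
      dsimp only
      rw [h1 j j.2, ← add_div, ← Finset.sum_add_distrib, eq_div_iff hm'.ne', sub_mul,
        div_mul_cancel₀ _ hm'.ne']
      simp only [sub_add_sub_cancel, Finset.sum_sub_distrib, Finset.sum_const, Finset.card_range,
        nsmul_eq_mul]
      ring
    rw [e]
    refine (abs_add_le _ _).trans (add_le_add le_rfl ?_)
    rw [abs_div, Nat.abs_cast]
    refine div_le_of_le_mul₀ hm'.le (by positivity) ((Finset.abs_sum_le_sum_abs _ _).trans ?_)
    refine (Finset.sum_le_sum (g := fun _ => L * (m * δ)) fun k hk => ?_).trans_eq ?_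
    · have hk := Finset.mem_range.1 hk
      refine (hL _ _ _).trans (mul_le_mul_of_nonneg_left ((h2 _ k hk).trans ?_) hL0)
      exact mul_le_mul_of_nonneg_right (by exact_mod_cast hk.le) hδ0
    · simp [mul_comm]
  have hemp : ∀ x, empCdf v x - returnCdf M pol γ (ϑ ω) x =
      (∑ j ∈ Finset.range n, r.rankDeviation γ i ϑ x j ω) / n := by
    intro x
    rw [← Fin.sum_univ_eq_sum_range (fun j => r.rankDeviation γ i ϑ x j ω) n, empCdf,
      sub_eq_iff_eq_add, eq_comm, ← eq_sub_iff_add_eq, div_eq_iff hn'.ne', sub_mul,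
      div_mul_cancel₀ _ hn'.ne']
    simp [rankDeviation, hv, Finset.sum_sub_distrib, mul_comm]
  have hmain := abs_sortedMetric_sub_uorMetric_le hW hW0 hJm hC0 hCJ hties hn (ϑ ω) u huC
  refine hmain.trans (mul_le_mul_of_nonneg_left ?_ hW00)
  have hi1 := (empCdf_mono u).intervalIntegrable (μ := volume) (a := -C) (b := C)
  have hi2 := (empCdf_mono v).intervalIntegrable (μ := volume) (a := -C) (b := C)
  have hi3 := (monotone_returnCdf (M := M) (pol := pol) (γ := γ) (ϑ ω)).intervalIntegrable
    (μ := volume) (a := -C) (b := C)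
  calc ∫ x in (-C)..C, |empCdf u x - returnCdf M pol γ (ϑ ω) x|
      ≤ ∫ x in (-C)..C, (|empCdf v x - returnCdf M pol γ (ϑ ω) x| + |empCdf u x - empCdf v x|) := by
        refine intervalIntegral.integral_mono_on (by linarith) (hi1.sub hi3).abs
          ((hi2.sub hi3).abs.add (hi1.sub hi2).abs) fun x _ => ?_
        rw [add_comm]
        exact abs_sub_le _ _ _
    _ = (∫ x in (-C)..C, |empCdf v x - returnCdf M pol γ (ϑ ω) x|) +
          ∫ x in (-C)..C, |empCdf u x - empCdf v x| :=
        intervalIntegral.integral_add (hi2.sub hi3).abs (hi1.sub hi2).abs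
    _ ≤ (∫ x in (-C)..C, |empCdf v x - returnCdf M pol γ (ϑ ω) x|) +
          (∑ j : Fin n, (|r.noise γ R i ϑ j ω| + L * (m * δ))) / n := by
        gcongr
        refine (integral_abs_empCdf_sub_le u v hC0 huC fun j => hCJ _ _).trans ?_
        exact div_le_div_of_nonneg_right (Finset.sum_le_sum fun j _ => huv j) hn'.le
    _ = _ := by
        simp_rw [hemp]
        rw [Finset.sum_add_distrib, add_div, add_assoc]
        congr 2
        rw [Finset.sum_const, Finset.card_univ, Fintype.card_fin, nsmul_eq_mul,
          mul_div_cancel_left₀ _ hn'.ne']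

theorem measurable_rankDeviation (hn : 0 < n) (hm : 0 < m)
    (hJ : Measurable fun x : Θ × P => J M pol γ x.1 x.2) {i : ℕ} {ϑ : Ω → Θ}
    (hϑ : Measurable[r.hist i] ϑ) (j : ℕ) :
    Measurable fun y : ℝ × Ω => r.rankDeviation γ i ϑ y.1 j y.2 := by
  have h1 : Measurable ϑ := hϑ.mono (r.hist.le i) le_rfl
  have h2 := r.measurable_p hn (i * n + j) hm
  refine Measurable.sub (Measurable.ite (measurableSet_le ?_ measurable_fst) measurable_const
    measurable_const) ?_
  · exact hJ.comp ((h1.comp measurable_snd).prodMk (h2.comp measurable_snd))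
  · exact (measurable_returnCdf hJ).comp ((h1.comp measurable_snd).prodMk measurable_fst)

/-- Averaging over normalized Lebesgue measure on `[-C, C]` replaces a bound on the supremum over
levels: only the `L¹`-distance matters. -/
theorem measure_integral_rankDeviation_ge_le [IsProbabilityMeasure μ] (hn : 0 < n) (hm : 0 < m)
    (hJ : Measurable fun x : Θ × P => J M pol γ x.1 x.2) {i : ℕ} {ϑ : Ω → Θ}
    (hϑ : Measurable[r.hist i] ϑ) {B : ℝ} (hB : r.PosteriorMixing B) {C : ℝ} (hC : 0 < C) {t : ℝ}
    (ht : 0 ≤ t) :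
    μ {ω | 2 * C * t ≤ ∫ x in (-C)..C, |(∑ j ∈ Finset.range n, r.rankDeviation γ i ϑ x j ω) / n|} ≤
      ENNReal.ofReal (2 * Real.exp (1 / 2) *
        Real.exp (-(n * t ^ 2 / (2 * (2 * max B 0 + 1) ^ 2)))) := by
  have hn' : (0 : ℝ) < n := by exact_mod_cast hn
  have hK : 0 < 2 * max B 0 + 1 := by positivity
  set ν : Measure ℝ := (ENNReal.ofReal (2 * C))⁻¹ • volume.restrict (Set.Ioc (-C) C) with hν
  have h2C : ENNReal.ofReal (2 * C) ≠ 0 := by simpa using hC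
  have : IsProbabilityMeasure ν := ⟨by
    rw [hν, Measure.smul_apply, Measure.restrict_apply_univ, Real.volume_Ioc, smul_eq_mul,
      sub_neg_eq_add, ← two_mul, ENNReal.inv_mul_cancel h2C ENNReal.ofReal_ne_top]⟩
  have hX : Measurable (Function.uncurry fun (x : ℝ) (ω : Ω) =>
      (∑ j ∈ Finset.range n, r.rankDeviation γ i ϑ x j ω) / n) :=
    (Finset.measurable_fun_sum _ fun j _ => r.measurable_rankDeviation hn hm hJ hϑ j).div_const _
  have hb : ∀ (x : ℝ) (ω : Ω), |(∑ j ∈ Finset.range n, r.rankDeviation γ i ϑ x j ω) / n| ≤ 1 := by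
    intro x ω
    rw [abs_div, Nat.abs_cast]
    refine div_le_of_le_mul₀ hn'.le zero_le_one ((Finset.abs_sum_le_sum_abs _ _).trans ?_)
    refine (Finset.sum_le_sum fun j _ => r.abs_rankDeviation_le γ i ϑ x j ω).trans_eq ?_
    simp
  have h := measure_le_integral_abs_le μ ν _ hX hb (by positivity)
    (.of_forall fun x => r.expMomentBound_rankDeviation hn hm hJ hϑ hB x) ht
  have hint : ∀ ω, (2 * C * t ≤ ∫ x in (-C)..C,
      |(∑ j ∈ Finset.range n, r.rankDeviation γ i ϑ x j ω) / n|) ↔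
      t ≤ ∫ x, |(∑ j ∈ Finset.range n, r.rankDeviation γ i ϑ x j ω) / n| ∂ν := by
    intro ω
    rw [hν, integral_smul_measure, intervalIntegral.integral_of_le (by linarith),
      ENNReal.toReal_inv, ENNReal.toReal_ofReal (by linarith), smul_eq_mul, ← div_eq_inv_mul,
      le_div_iff₀ (by linarith), mul_comm]
  simp_rw [hint]
  refine h.trans_eq ?_
  congr 4
  field_simp
  ring

/-- Here the average is over the uniform measure on clusters; the tail depends on `m` alone,
whatever the dependence between clusters. -/
theorem measure_sum_noise_ge_le [IsProbabilityMeasure μ] (hn : 0 < n) (hm : 0 < m) (hγ0 : 0 ≤ γ) (hγ1 : γ < 1)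
    (hR0 : 0 ≤ R) (hR : BoundedReward M R) {i : ℕ} {ϑ : Ω → Θ} (hϑ : Measurable[r.hist i] ϑ)
    {t : ℝ} (ht : 0 ≤ t) :
    μ {ω | t ≤ (∑ j : Fin n, |r.noise γ R i ϑ j ω|) / n} ≤
      ENNReal.ofReal (2 * Real.exp (-(m * t ^ 2 / (2 * (2 * (R / (1 - γ) + 1)) ^ 2)))) := by
  have hn' : (0 : ℝ) < n := by exact_mod_cast hn
  have hm' : (0 : ℝ) < m := by exact_mod_cast hm
  have hC' : 0 ≤ R / (1 - γ) := div_nonneg hR0 (by linarith)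
  set ν : Measure (Fin n) := (n : ℝ≥0∞)⁻¹ • Measure.count with hν
  have : IsProbabilityMeasure ν := ⟨by
    rw [hν, Measure.smul_apply, Measure.count_univ, smul_eq_mul]
    simp only [ENat.card_eq_coe_fintype_card, Fintype.card_fin, ENat.toENNReal_coe]
    exact ENNReal.inv_mul_cancel (by exact_mod_cast hn.ne') (ENNReal.natCast_ne_top n)⟩
  have hX : Measurable (Function.uncurry fun (j : Fin n) (ω : Ω) => r.noise γ R i ϑ j ω) := by
    have hj : ∀ j : Fin n, Measurable fun ω => r.noise γ R i ϑ j ω := fun j =>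
      r.measurable_noise hγ0 hγ1 hR0 hR hϑ j.2
    generalize hY : (fun (j : Fin n) (ω : Ω) => r.noise γ R i ϑ j ω) = Y
    have hj' : ∀ j, Measurable (Y j) := hY ▸ hj
    exact measurable_from_prod_countable_right hj'
  have hσ : 0 < m * (2 * (R / (1 - γ) + 1)) ^ 2 / 2 / (m : ℝ) ^ 2 := by positivity
  have hK : ∀ (j : Fin n) (ω : Ω), |r.noise γ R i ϑ j ω| ≤ 2 * (R / (1 - γ) + 1) := fun j ω =>
    r.abs_noise_le hγ0 hγ1 hR0 hR j ω
  have hA : ∀ᵐ j ∂ν, ExpMomentBound μ (fun ω => r.noise γ R i ϑ (j : Fin n) ω) 1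
      (m * (2 * (R / (1 - γ) + 1)) ^ 2 / 2 / (m : ℝ) ^ 2) :=
    .of_forall fun j => r.expMomentBound_noise hγ0 hγ1 hR0 hR hϑ j.2
  have h := measure_le_integral_abs_le μ ν _ hX hK hσ hA ht
  have hint : ∀ ω, (∑ j : Fin n, |r.noise γ R i ϑ j ω|) / n =
      ∫ j : Fin n, |r.noise γ R i ϑ j ω| ∂ν := by
    intro ω
    rw [hν, integral_smul_measure, integral_count, ENNReal.toReal_inv, ENNReal.toReal_natCast,
      smul_eq_mul, ← div_eq_inv_mul]
  simp_rw [hint]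
  refine h.trans_eq ?_
  rw [mul_one]
  have e : t ^ 2 / (4 * (m * (2 * (R / (1 - γ) + 1)) ^ 2 / 2 / (m : ℝ) ^ 2)) =
      m * t ^ 2 / (2 * (2 * (R / (1 - γ) + 1)) ^ 2) := by
    have hc : R / (1 - γ) + 1 ≠ 0 := by positivity
    generalize R / (1 - γ) + 1 = c at hc
    field_simp
    ring
  rw [e]

end DFRun

end Deviation

/-! ### Choice of the sample sizes. -/

/-- A number of samples of order `-log ρ / ε ^ (2 * d + 2)` makes an exponential tail in
`x * ε ^ 2` smaller than a fraction of `ρ`, uniformly for bounded `ε`. -/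
theorem exists_sample_size {A a E ρ₀ : ℝ} (hA : 0 < A) (ha : 0 < a) (hE : 0 < E) (hρ₀ : ρ₀ < 1)
    (d : ℕ) :
    ∃ c, 0 < c ∧ ∀ ε ρ x : ℝ, 0 < ε → ε ≤ E → 0 < ρ → ρ ≤ ρ₀ →
      c * (-Real.log ρ / ε ^ (2 * d + 2)) < x → A * Real.exp (-(a * x * ε ^ 2)) ≤ ρ / 8 := by
  rcases le_or_gt ρ₀ 0 with h0 | h0
  · exact ⟨1, one_pos, fun ε ρ x _ _ hρ hρ' => absurd (hρ.trans_le (hρ'.trans h0)) (lt_irrefl 0)⟩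
  have hlog : 0 < -Real.log ρ₀ := neg_pos.2 (Real.log_neg h0 hρ₀)
  -- Because `-log ρ ≥ -log ρ₀ > 0`, the prefactor `8 * A` is absorbed into a multiple of `-log ρ`.
  set κ := 1 + |Real.log (8 * A)| / -Real.log ρ₀ with hκ
  have hκ0 : 0 < κ := by positivity
  refine ⟨κ * E ^ (2 * d) / a, by positivity, fun ε ρ x hε hεE hρ hρ' hx => ?_⟩
  have hle : -Real.log ρ₀ ≤ -Real.log ρ := neg_le_neg (Real.log_le_log hρ hρ')
  -- The surplus `ε ^ (-2d)` in the sample size is at least `E ^ (-2d)`; the constant carries the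
  -- compensating `E ^ (2d)`.
  have hy : κ * -Real.log ρ ≤ a * x * ε ^ 2 := by
    have h1 : ε ^ (2 * d) ≤ E ^ (2 * d) := pow_le_pow_left₀ hε.le hεE _
    have h2 : κ * -Real.log ρ ≤ κ * -Real.log ρ * (E ^ (2 * d) / ε ^ (2 * d)) :=
      le_mul_of_one_le_right (by have := hlog.trans_le hle; positivity)
        ((one_le_div (by positivity)).2 h1)
    have h3 : a * (κ * E ^ (2 * d) / a * (-Real.log ρ / ε ^ (2 * d + 2))) * ε ^ 2 ≤
        a * x * ε ^ 2 := by gcongr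
    refine h2.trans (le_of_eq_of_le ?_ h3)
    rw [pow_add]
    field_simp
  have hκρ : Real.log (8 * A) + -Real.log ρ ≤ κ * -Real.log ρ := by
    rw [hκ, add_mul, one_mul, add_comm]
    gcongr
    rw [div_mul_eq_mul_div, le_div_iff₀ hlog]
    exact (mul_le_mul_of_nonneg_right (le_abs_self _) hlog.le).trans
      (mul_le_mul_of_nonneg_left hle (abs_nonneg _))
  have h : Real.exp (-(a * x * ε ^ 2)) ≤ ρ / (8 * A) := by
    rw [← Real.exp_log (by positivity : 0 < ρ / (8 * A)), Real.log_div hρ.ne' (by positivity)]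
    exact Real.exp_le_exp.2 (by linarith)
  calc A * Real.exp (-(a * x * ε ^ 2)) ≤ A * (ρ / (8 * A)) := by gcongr
    _ = ρ / 8 := by field_simp

/-! ### Concentration for a policy fixed by the history. -/

section Concentration

variable {S A Θ : Type*} [MeasurableSpace S] [MeasurableSpace A] [MeasurableSpace Θ] {d : ℕ}
  {P : Set (EuclideanSpace ℝ (Fin d))} {M : PMDP S A P} {pol : Kernel (Θ × S) A}
  [IsMarkovKernel pol] {γ R : ℝ} {W : ℝ → ℝ} {n m : ℕ} {Ω : Type*} [MeasurableSpace Ω]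
  {μ : Measure Ω}

/-- Concentration of the metric evaluated for a policy that is chosen on the basis of the
history. -/
theorem DFRun.measure_abs_metric_sub_uorMetric_ge_le [IsProbabilityMeasure μ]
    (r : DFRun M pol n m μ) (hn : 0 < n) (hm : 0 < m) (hW : AntitoneOn W (Set.Icc 0 1))
    (hW0 : ∀ x ∈ Set.Icc (0 : ℝ) 1, 0 ≤ W x) (hγ0 : 0 ≤ γ) (hγ1 : γ < 1) (hR0 : 0 ≤ R)
    (hR : BoundedReward M R) (hties : NoTies M pol γ) {L : ℝ} (hL0 : 0 ≤ L)
    (hL : ∀ θ p p', |J M pol γ θ p - J M pol γ θ p'| ≤ L * dist p p') {δ : ℝ}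
    (hδ : r.SlowDrift δ) (hδ0 : 0 ≤ δ) {B : ℝ} (hB : r.PosteriorMixing B) {i : ℕ} {ϑ : Ω → Θ}
    (hϑ : Measurable[r.hist i] ϑ) {w t₁ t₂ : ℝ} (hw0 : 0 < w) (hw : W 0 ≤ w) (ht₁ : 0 ≤ t₁)
    (ht₂ : 0 ≤ t₂) :
    μ {ω | w * (2 * (R / (1 - γ) + 1) * t₁ + t₂ + L * (m * δ)) ≤
        |r.metric γ W i (ϑ ω) ω - uorMetric M pol γ W (ϑ ω)|} ≤
      ENNReal.ofReal (2 * Real.exp (1 / 2) *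
        Real.exp (-(n * t₁ ^ 2 / (2 * (2 * max B 0 + 1) ^ 2)))) +
      ENNReal.ofReal (2 * Real.exp (-(m * t₂ ^ 2 / (2 * (2 * (R / (1 - γ) + 1)) ^ 2)))) := by
  have hC : 0 < R / (1 - γ) + 1 := by
    have : 0 ≤ R / (1 - γ) := div_nonneg hR0 (by linarith)
    linarith
  have h1 := r.measure_integral_rankDeviation_ge_le hn hm (measurable_J hγ0 hγ1 hR0 hR) hϑ hB hC
    ht₁
  have h2 := r.measure_sum_noise_ge_le hn hm hγ0 hγ1 hR0 hR hϑ ht₂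
  refine ((measure_mono_ae ?_).trans (measure_union_le _ _)).trans (add_le_add h1 h2)
  filter_upwards [r.ae_abs_metric_sub_uorMetric_le hn hm hW hW0 hγ0 hγ1 hR0 hR hties hL0 hL hδ hδ0
    hϑ] with ω hω hbad
  by_contra hcon
  obtain ⟨hc1, hc2⟩ := not_or.1 hcon
  rw [Set.mem_ofPred_eq, not_le] at hc1
  rw [Set.mem_ofPred_eq, not_le] at hc2
  have hI : 0 ≤ ∫ x in (-(R / (1 - γ) + 1))..(R / (1 - γ) + 1),
      |(∑ j ∈ Finset.range n, r.rankDeviation γ i ϑ x j ω) / n| :=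
    intervalIntegral.integral_nonneg (by linarith) fun _ _ => abs_nonneg _
  have hN : 0 ≤ (∑ j : Fin n, |r.noise γ R i ϑ j ω|) / n := by positivity
  have hD : 0 ≤ L * (m * δ) := by positivity
  refine absurd ((show _ ≤ _ from hbad).trans (hω.trans (mul_le_mul_of_nonneg_right hw ?_))) ?_
  · linarith
  · rw [not_le]
    exact mul_lt_mul_of_pos_left (by linarith) hw0

end Concentration

end

end UORRL

/-! ### Suboptimality of the output policy. -/

theorem theorem4 {S A Θ : Type*} [MeasurableSpace S] [MeasurableSpace A] [MeasurableSpace Θ]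
    {d : ℕ} (P : Set (EuclideanSpace ℝ (Fin d)))
    (γ : ℝ) (hγ0 : 0 ≤ γ) (hγ1 : γ < 1)
    (W : ℝ → ℝ) (hW : AntitoneOn W (Set.Icc 0 1)) (hW0 : ∀ x ∈ Set.Icc (0 : ℝ) 1, 0 ≤ W x)
    (Rmax LT LR : ℝ) :
    ∃ υ : ℝ, 0 < υ ∧
      ∀ B ρ₀ : ℝ, ρ₀ < 1 →
        ∃ c₁ c₂ : ℝ, 0 < c₁ ∧ 0 < c₂ ∧
          ∀ (M : UORRL.PMDP S A P) (pol : ProbabilityTheory.Kernel (Θ × S) A)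
            [ProbabilityTheory.IsMarkovKernel pol],
            UORRL.BoundedReward M Rmax → UORRL.TransitionLipschitz M LT →
            UORRL.RewardLipschitz M LR → UORRL.NoTies M pol γ →
            ∀ ε ρ : ℝ, 0 < ε → 0 < ρ → ρ ≤ ρ₀ →
              ∀ n m : ℕ, c₁ * (-Real.log ρ / ε ^ 2) < n →
                c₂ * (-Real.log ρ / ε ^ (2 * d + 2)) < m →
                ∀ {Ω : Type*} [MeasurableSpace Ω] (μ : MeasureTheory.Measure Ω)
                  [MeasureTheory.IsProbabilityMeasure μ] (r : UORRL.DFRun M pol n m μ),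
                  r.SlowDrift (υ * ε / (2 * m)) → r.PosteriorMixing B →
                  ∀ i : ℕ,
                    μ {ω | (∀ ϑ : Θ, r.metric γ W i ϑ ω - ε / 2 ≤ r.metric γ W i (r.θ i ω) ω) ∧
                        ¬ ∀ ϑ : Θ, UORRL.uorMetric M pol γ W ϑ - ε ≤
                          UORRL.uorMetric M pol γ W (r.θ i ω)} < ENNReal.ofReal ρ := by
  -- No signs are assumed for `Rmax`, `LT`, `LR`; absolute values and added units make `C`, `w` and
  -- `L` positive.
  have hR0 : 0 ≤ |Rmax| := abs_nonneg _
  set C := |Rmax| / (1 - γ) + 1 with hCdef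
  have hC' : 0 ≤ |Rmax| / (1 - γ) := div_nonneg hR0 (by linarith)
  have hC0 : 0 < C := by linarith
  have hW00 : 0 ≤ W 0 := hW0 0 ⟨le_rfl, zero_le_one⟩
  set w := W 0 + 1 with hw
  have hw0 : 0 < w := by linarith
  set L := |UORRL.returnLip γ |Rmax| LT LR| + 1 with hLdef
  have hL0 : 0 < L := by positivity
  -- With drift `υ * ε / (2 * m)` per execution, the drift term `w * L * m * δ` is `ε / 16`, half of
  -- the error budget `ε / 8`.
  refine ⟨1 / (8 * w * L), by positivity, fun B ρ₀ hρ₀ => ?_⟩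
  have hK : 0 < 2 * max B 0 + 1 := by positivity
  -- The last argument `0` gives the rate `ε ^ 2` for the number of clusters. The cap `E` on `ε` is
  -- harmless, since beyond it the claim is trivial.
  obtain ⟨c₁, hc₁, htail₁⟩ := UORRL.exists_sample_size (A := 2 * Real.exp (1 / 2))
    (a := 1 / ((64 * C * w) ^ 2 * (2 * (2 * max B 0 + 1) ^ 2))) (E := 2 * C * w) (by positivity)
    (by positivity) (by positivity) hρ₀ 0
  obtain ⟨c₂, hc₂, htail₂⟩ := UORRL.exists_sample_size (A := 2)
    (a := 1 / ((32 * w) ^ 2 * (2 * (2 * C) ^ 2))) (E := 2 * C * w) (by positivity)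
    (by positivity) (by positivity) hρ₀ d
  refine ⟨c₁, c₂, hc₁, hc₂, ?_⟩
  intro M pol _ hR hT hLR hties ε ρ hε hρ hρρ₀ n m hn hm Ω _ μ _ r hδ hB i
  have hR' : UORRL.BoundedReward M |Rmax| := fun x => by
    filter_upwards [hR x] with y hy using hy.trans (le_abs_self _)
  have hCJ : ∀ θ p, |UORRL.J M pol γ θ p| ≤ C := fun θ p =>
    (UORRL.abs_J_le hγ0 hγ1 hR0 hR' θ p).trans (by linarith)
  have huor : ∀ θ, |UORRL.uorMetric M pol γ W θ| ≤ C * W 0 :=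
    UORRL.abs_uorMetric_le hW hW0 hCJ
  have hρ' : ENNReal.ofReal ρ ≠ 0 := by simpa using hρ
  -- All UOR values lie within `C * W 0` of zero, so for larger `ε` every policy is `ε`-suboptimal
  -- and the bad event is empty.
  rcases lt_or_ge (2 * C * w) ε with hbig | hsmall
  · refine lt_of_eq_of_lt ?_ (pos_iff_ne_zero.2 hρ')
    convert measure_empty (μ := μ) using 2
    refine Set.eq_empty_of_forall_notMem fun ω hω => hω.2 fun ϑ => ?_
    have h1 := abs_le.1 (huor ϑ)
    have h2 := abs_le.1 (huor (r.θ i ω))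
    have h3 : C * W 0 ≤ C * w := mul_le_mul_of_nonneg_left (by linarith) hC0.le
    linarith [h1.2, h2.1]
  have hlog : 0 < -Real.log ρ := neg_pos.2 (Real.log_neg hρ (hρρ₀.trans_lt hρ₀))
  have hn0 : 0 < n := by
    have : (0 : ℝ) < n := lt_trans (by positivity) hn
    exact_mod_cast this
  have hm' : (0 : ℝ) < m := lt_trans (by positivity) hm
  have hm0 : 0 < m := by exact_mod_cast hm'
  have hLip : ∀ θ p p', |UORRL.J M pol γ θ p - UORRL.J M pol γ θ p'| ≤ L * dist p p' :=
    fun θ p p' => (UORRL.abs_J_sub_le hγ0 hγ1 hR0 hR' hT hLR θ p p').trans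
      (mul_le_mul_of_nonneg_right ((le_abs_self _).trans (by linarith)) dist_nonneg)
  have hconc : ∀ ϑ : Ω → Θ, Measurable[r.hist i] ϑ →
      μ {ω | ε / 8 ≤ |r.metric γ W i (ϑ ω) ω - UORRL.uorMetric M pol γ W (ϑ ω)|} ≤
        ENNReal.ofReal (ρ / 4) := by
    intro ϑ hϑ
    have h := r.measure_abs_metric_sub_uorMetric_ge_le hn0 hm0 hW hW0 hγ0 hγ1 hR0 hR' hties hL0.le
      hLip hδ (by positivity) hB hϑ (t₁ := ε / (64 * C * w)) (t₂ := ε / (32 * w)) hw0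
      (by linarith) (by positivity) (by positivity)
    rw [← hCdef] at h
    -- The budget: `ε / 32` each for mixing and noise, and `ε / 16` for drift.
    have e1 : w * (2 * C * (ε / (64 * C * w)) + ε / (32 * w) +
        L * (m * (1 / (8 * w * L) * ε / (2 * m)))) = ε / 8 := by
      field_simp
      norm_num
    have e2 : n * (ε / (64 * C * w)) ^ 2 / (2 * (2 * max B 0 + 1) ^ 2) =
        1 / ((64 * C * w) ^ 2 * (2 * (2 * max B 0 + 1) ^ 2)) * n * ε ^ 2 := by
      field_simp
    have e3 : m * (ε / (32 * w)) ^ 2 / (2 * (2 * C) ^ 2) =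
        1 / ((32 * w) ^ 2 * (2 * (2 * C) ^ 2)) * m * ε ^ 2 := by
      field_simp
    rw [e1, e2, e3] at h
    refine h.trans ?_
    rw [← ENNReal.ofReal_add (by positivity) (by positivity)]
    refine ENNReal.ofReal_le_ofReal ?_
    have h1 := htail₁ ε ρ n hε hsmall hρ hρρ₀ (by simpa using hn)
    have h2 := htail₂ ε ρ m hε hsmall hρ hρρ₀ hm
    linarith
  obtain ⟨ω₀⟩ : Nonempty Ω := nonempty_of_isProbabilityMeasure μ
  have : Nonempty Θ := ⟨r.θ 0 ω₀⟩
  have hbdd : BddAbove (Set.range (UORRL.uorMetric M pol γ W)) :=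
    ⟨C * W 0, by rintro _ ⟨θ, rfl⟩; exact (abs_le.1 (huor θ)).2⟩
  -- A deterministic policy within `ε / 4` of the supremum stands in for all competitors.
  obtain ⟨θ', hθ'⟩ := exists_lt_of_lt_ciSup
    (sub_lt_self (⨆ θ, UORRL.uorMetric M pol γ W θ) (by positivity : 0 < ε / 4))
  have h1 := hconc (r.θ i) (r.θ_hist i)
  have h2 := hconc (fun _ => θ') measurable_const
  -- The bad event quantifies over all policies and need not be measurable; monotonicity and
  -- subadditivity of the outer measure suffice. The losses add up to `ε/4 + ε/8 + ε/2 + ε/8 = ε`,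
  -- the probabilities to `ρ/2 < ρ`.
  refine (((measure_mono ?_).trans (measure_union_le _ _)).trans (add_le_add h1 h2)).trans_lt ?_
  · rintro ω ⟨hopt, hbad⟩
    by_contra hcon
    obtain ⟨hc1, hc2⟩ := not_or.1 hcon
    rw [Set.mem_ofPred_eq, not_le, abs_lt] at hc1
    rw [Set.mem_ofPred_eq, not_le, abs_lt] at hc2
    refine hbad fun ϑ => ?_
    have := le_ciSup hbdd ϑ
    have := hopt θ'
    linarith [hc1.1, hc1.2, hc2.1, hc2.2]
  · rw [← ENNReal.ofReal_add (by positivity) (by positivity)]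
    exact (ENNReal.ofReal_lt_ofReal_iff hρ).2 (by linarith)
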